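/- \textbf{Setting.} Let $\Omega\subset\mathbb R$ be open, $s\ge 1$ an integer, $N:\Omega\to\mathbb R$ of class $C^s$, $u^0\in\Omega$, and let $u:(T_\star,T^\star)\to\Omega$, with $-\infty\le T_\star<0<T^\star\le+\infty$, be a solution (for instance the maximal one) of $u'(t)=N(u(t))u(t)$, $u(0)=u^0$. Fix $T\in(0,T^\star)$ and $r>0$ such that $V=\{u(t)+v : t\in[0,T],\ v\in\mathbb R,\ |v|\le r\}\subset\Omega$. Put $M=\sup_{t\in[0,T]}|N(u(t))|$ and let $m>0$ be such that $M+m>\sup_{x\in V}|N(x)|$. \textbf{Method.} Let $0\le c_1<\dots<c_s\le1$, let $\ell_1,\dots,\ell_s$ be the Lagrange polynomials at $c_1,\dots,c_s$, and let $a_{i,j}=\int_0^{c_i}\ell_j(\tau)\,d\tau$, $b_i=\int_0^1\ell_i(\tau)\,d\tau$ be the coefficients of the corresponding Runge--Kutta collocation method (which has order at least $s$). Let $D$ be a real $s\times s$ matrix and $\theta\in\mathbb R^s$. For $h>0$ set $t_n=nh$. Given $u_0\in\mathbb R$ and $(\gamma_{-1+c_i})_{1\le i\le s}\in\mathbb R^s$,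 define for $n\ge0$ $$\gamma_{n+c_i}=\sum_{j=1}^s D_{ij}\gamma_{n-1+c_j}+\theta_i N(u_n),\qquad u_{n,i}=u_n+h\sum_{j=1}^s a_{i,j}\gamma_{n+c_j}u_{n,j}\quad(1\le i\le s),\qquad u_{n+1}=u_n+h\sum_{i=1}^s b_i\gamma_{n+c_i}u_{n,i},$$ where the second relation is a linear system for $(u_{n,1},\dots,u_{n,s})$. Assume that the first (auxiliary) step is strongly stable, i.e. every complex eigenvalue of $D$ has modulus $<1$, and consistent of order $s$, i.e. for all $h>0$, $V_c^h=DV_{c-\mathbf 1}^h+\Theta$, where $(V_c^h)_{ij}=(c_ih)^{j-1}$, $(V_{c-\mathbf 1}^h)_{ij}=((c_i-1)h)^{j-1}$, and $\Theta$ has first column $\theta$ and all other columns zero. \textbf{Theorem.} There exist constants $C>0$ and $h_0>0$, with $h_0<-T_\star$, $u(t)\in V$ for $t\in[-h_0,0]$, $Ce^{CT}h_0^s<r$ and $Ce^{CT}h_0^s<m$, such that the following holds for all $h\in(0,h_0)$ and all $u_0\in\mathbb R$, $(\gamma_{-1+c_i})_{1\le i\le s}\in\mathbb R^s$. Set $\varepsilon=\max_{1\le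 i\le s}|\gamma_{-1+c_i}-N(u(t_{-1}+c_ih))|$. If $$e^{CT}\bigl(|u^0-u_0|+C(\varepsilon+h_0^s)\bigr)<r\quad\text{and}\quad Ce^{CT}\bigl(|u^0-u_0|+\varepsilon+h_0^s\bigr)<m,$$ then: (i) for all $n\in\mathbb N$ with $t_{n-1}\le T$, the value $u_n$ lies in $\Omega$ and the linear system for $(u_{n,i})_{1\le i\le s}$ has a unique solution in $\mathbb R^s$; (ii) for all $n\in\mathbb N$ with $t_n\le T$, one has $|\gamma_{n-1+c_i}|\le M+m$ for all $1\le i\le s$, and $$\max_{0\le k\le n}|u(t_k)-u_k|\le e^{Cnh}\Bigl[|u^0-u_0|+C\Bigl(\max_{1\le i\le s}|\gamma_{-1+c_i}-N(u(t_{-1}+c_ih))|+h^s\Bigr)\Bigr].$$ -/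

import Mathlib

open Set

noncomputable section

namespace LinImplicit

/-- The numerical coefficients of an `s`-stage linearly implicit method: a Runge-Kutta tableau
`(c, A, b)` and the coefficients `(D, θ)` of the auxiliary step. -/
structure Method (s : ℕ) where
  c : Fin s → ℝ
  A : Matrix (Fin s) (Fin s) ℝ
  b : Fin s → ℝ
  D : Matrix (Fin s) (Fin s) ℝ
  θ : Fin s → ℝ

variable {s : ℕ}

/-- `(c, A, b)` is a Runge-Kutta collocation method with nodes `0 ≤ c₁ < ⋯ < c_s ≤ 1`:
`a i j = ∫₀^{c i} ℓ j` and `b i = ∫₀¹ ℓ i`, where the `ℓ j` are the Lagrange polynomials at the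
nodes. (Such a method has order at least `s`.) -/
structure Method.IsCollocation (P : Method s) : Prop where
  strictMono : StrictMono P.c
  mem_Icc : ∀ i, P.c i ∈ Icc (0 : ℝ) 1
  A_eq : ∀ i j, P.A i j = ∫ τ in (0 : ℝ)..P.c i, (Lagrange.basis Finset.univ P.c j).eval τ
  b_eq : ∀ i, P.b i = ∫ τ in (0 : ℝ)..1, (Lagrange.basis Finset.univ P.c i).eval τ

/-- The auxiliary step is strongly stable: the largest modulus of the complex eigenvalues of `D`
is less than one. -/
def Method.IsStronglyStable (P : Method s) : Prop :=
  spectralRadius ℂ (P.D.map (algebraMap ℝ ℂ)) < 1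

/-- The matrix with first column `θ` and all other columns zero. -/
def Method.Theta (P : Method s) : Matrix (Fin s) (Fin s) ℝ :=
  Matrix.of fun i j => if (j : ℕ) = 0 then P.θ i else 0

/-- The auxiliary step is consistent of order `s`: `V_c^h = D V_{c-1}^h + Θ` for all `h > 0`,
where `V_c^h = ((c i * h) ^ (j - 1))` and `V_{c-1}^h = (((c i - 1) * h) ^ (j - 1))`,
`1 ≤ i, j ≤ s`. -/
def Method.IsConsistent (P : Method s) : Prop :=
  ∀ h : ℝ, 0 < h →
    Matrix.vandermonde (fun i => P.c i * h) =
      P.D * Matrix.vandermonde (fun i => (P.c i - 1) * h) + P.Theta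

/-- The auxiliary step: from `u_n` and `Γ_{n-1}` (components `γ_{n-1+c_i}`) to
`Γ_n = D Γ_{n-1} + N(u_n) θ`. -/
def Method.nextGamma (P : Method s) (N : ℝ → ℝ) (v : ℝ) (Γ : Fin s → ℝ) : Fin s → ℝ :=
  P.D.mulVec Γ + N v • P.θ

/-- `U` solves the linear stage system
`U i = v + h ∑ j, a i j * g j * U j`, with `v = u_n` and `g = Γ_n`. -/
def Method.IsStageSolution (P : Method s) (h v : ℝ) (g U : Fin s → ℝ) : Prop :=
  ∀ i, U i = v + h * ∑ j, P.A i j * g j * U j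

/-- A solution of the linear stage system (an arbitrary vector if there is none). -/
def Method.stages (P : Method s) (h v : ℝ) (g : Fin s → ℝ) : Fin s → ℝ :=
  Classical.epsilon (P.IsStageSolution h v g)

/-- One step `(u_n, Γ_{n-1}) ↦ (u_{n+1}, Γ_n)` of the method for `u' = N(u) u`, with
`u_{n+1} = u_n + h ∑ i, b i * γ_{n+c_i} * u_{n,i}`. -/
def Method.step (P : Method s) (N : ℝ → ℝ) (h : ℝ) (x : ℝ × (Fin s → ℝ)) :
    ℝ × (Fin s → ℝ) :=
  let g := P.nextGamma N x.1 x.2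
  (x.1 + h * ∑ i, P.b i * g i * P.stages h x.1 g i, g)

/-- The state `(u_n, Γ_{n-1})` after `n` steps from the data `(u_0, Γ_{-1}) = (v, Γ)`. -/
def Method.state (P : Method s) (N : ℝ → ℝ) (h v : ℝ) (Γ : Fin s → ℝ) (n : ℕ) :
    ℝ × (Fin s → ℝ) :=
  (P.step N h)^[n] (v, Γ)

/-- The numerical value `u_n`. -/
def Method.numU (P : Method s) (N : ℝ → ℝ) (h v : ℝ) (Γ : Fin s → ℝ) (n : ℕ) : ℝ :=
  (P.state N h v Γ n).1

/-- The auxiliary vector `Γ_{n-1}`, with components `γ_{n-1+c_i}` (note the shift: the value at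
`n = 0` is the starting vector `Γ_{-1}`). -/
def Method.numGammaPrev (P : Method s) (N : ℝ → ℝ) (h v : ℝ) (Γ : Fin s → ℝ) (n : ℕ) :
    Fin s → ℝ :=
  (P.state N h v Γ n).2

/-- `u` solves `u' = N(u) u`, `u(0) = x₀`, with values in `Ω`, on the open interval
`(Tlo, Thi)`, whose end points may be infinite. -/
structure IsSolutionOn (N : ℝ → ℝ) (Ω : Set ℝ) (x₀ : ℝ) (u : ℝ → ℝ) (Tlo Thi : EReal) :
    Prop where
  init : u 0 = x₀
  mem : ∀ t : ℝ, Tlo < t → (t : EReal) < Thi → u t ∈ Ω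
  deriv : ∀ t : ℝ, Tlo < t → (t : EReal) < Thi → HasDerivAt u (N (u t) * u t) t

/-- The closed `r`-neighbourhood `V = {u(t) + v | t ∈ [0,T], |v| ≤ r}` of the trajectory. -/
def tube (u : ℝ → ℝ) (T r : ℝ) : Set ℝ :=
  {x | ∃ t ∈ Icc (0 : ℝ) T, ∃ v : ℝ, |v| ≤ r ∧ x = u t + v}

/-- The initial error `max_i |γ_{-1+c_i} - N(u(t_{-1} + c_i h))|`, where `t_{-1} = -h`. -/
def Method.initErr (P : Method s) (N u : ℝ → ℝ) (h : ℝ) (Γ : Fin s → ℝ) : ℝ :=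
  ⨆ i, |Γ i - N (u (-h + P.c i * h))|

end LinImplicit

end

/-!
Let `y n = |u (t_n) - u_n|` and let `η n` be the error of the auxiliary vector `Γ_{n-1}` with
respect to the exact values `N (u (t_{n-1} + c i h))`.

* By Gelfand's formula, strong stability makes `D` a strict contraction, of ratio `ρ < 1`, for a
  seminorm `q` equivalent to the sup norm (`exists_contracting_seminorm`).
* A solution of `u' = N(u) u` is of class `C^s`, as are `N ∘ u` and `(N ∘ u) u`, so both are within
  `O(h^s)` of a polynomial of degree less than `s` on each step, uniformly in the step
  (`exists_uniform_taylor`). Consistency says that the auxiliary step is exact on such polynomials,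
  and collocation that the quadrature rules are; hence the exact solution satisfies the
  auxiliary step up to `O(h^s)` and the Runge-Kutta relations up to `O(h^{s+1})`
  (`exists_defect_bound`).
* Writing `z n = q (η n)`, subtraction of the numerical scheme from these relations gives, as long
  as `u_n` is in the tube and `Γ_n` is bounded,
  `z (n+1) ≤ ρ z n + c y n + c h^s` and
  `y (n+1) ≤ (1 + c h) y n + c h z (n+1) + c h^{s+1}`.
  With `μ = c / (1 - ρ)` the combined error `y n + μ h z n` grows by a factor `1 + O(h)` per step
  only, and `z` stays bounded by `z 0 + μ (max y + h^s)`. The closeness hypotheses make these bounds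
  smaller than the margins `r` and `m`, so that the recursion never stops being available
  (`coupled_recursion_bound`, `ErrorConstants.error_bounds`).

Bounded `Γ_n` and small `h` make the stage system a perturbation of the identity, hence uniquely
solvable. At the one step where `t_n` may exceed `T`, the value `u_n` is within `O(h)` of the
compact tube, hence still in `Ω`.
-/

open Set

noncomputable section

namespace LinImplicit

/-! ### A seminorm contracted by a strongly stable matrix -/

section AdaptedSeminorm

open scoped Matrix.Norms.Operator

variable {ι : Type*} [Fintype ι] [DecidableEq ι]

/-- Gelfand's formula for a real matrix whose complexification has spectral radius below one. -/
theorem exists_norm_pow_le_of_spectralRadius_lt_one (D : Matrix ι ι ℝ)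
    (hD : spectralRadius ℂ (D.map (algebraMap ℝ ℂ)) < 1) :
    ∃ ρ : ℝ, 0 < ρ ∧ ρ < 1 ∧ ∃ K : ℕ, 0 < K ∧ ‖D ^ K‖ ≤ ρ ^ K := by
  obtain ⟨ρ, hρ, hρ1⟩ := ENNReal.lt_iff_exists_nnreal_btwn.1 hD
  have hlim := spectrum.pow_nnnorm_pow_one_div_tendsto_nhds_spectralRadius
    (D.map (algebraMap ℝ ℂ))
  obtain ⟨K, hK, hK0⟩ :=
    ((hlim.eventually_lt_const hρ).and (Filter.eventually_gt_atTop 0)).exists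
  have hpos : 0 < ρ := by
    rcases eq_or_ne ρ 0 with h | h
    · simp [h] at hρ
    · exact pos_iff_ne_zero.2 h
  refine ⟨ρ, by exact_mod_cast hpos, by exact_mod_cast hρ1, K, hK0, ?_⟩
  have hK' : (0 : ℝ) < K := by exact_mod_cast hK0
  have h1 : (‖(D.map (algebraMap ℝ ℂ)) ^ K‖₊ : ENNReal) ≤ (ρ : ENNReal) ^ K := by
    have := ENNReal.rpow_le_rpow hK.le hK'.le
    rwa [← ENNReal.rpow_mul, one_div_mul_cancel hK'.ne', ENNReal.rpow_one,
      ENNReal.rpow_natCast] at this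
  have h2 : ‖(D.map (algebraMap ℝ ℂ)) ^ K‖₊ = ‖D ^ K‖₊ := by
    rw [← Matrix.map_pow]
    simp [Matrix.linfty_opNNNorm_def]
  rw [h2] at h1
  exact_mod_cast h1

/-- A strongly stable matrix is a strict contraction for a suitable seminorm equivalent to the
sup norm, namely `x ↦ ∑ k < K, ρ⁻ᵏ ‖Dᵏ x‖` where `‖D ^ K‖ ≤ ρ ^ K`. -/
theorem exists_contracting_seminorm (D : Matrix ι ι ℝ)
    (hD : spectralRadius ℂ (D.map (algebraMap ℝ ℂ)) < 1) :
    ∃ (q : Seminorm ℝ (ι → ℝ)) (ρ κ : ℝ), 0 < ρ ∧ ρ < 1 ∧ 0 ≤ κ ∧ (∀ x, ‖x‖ ≤ q x) ∧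
      (∀ x, q x ≤ κ * ‖x‖) ∧ ∀ x, q (D.mulVec x) ≤ ρ * q x := by
  obtain ⟨ρ, hρ, hρ1, K, hK, hDK⟩ := exists_norm_pow_le_of_spectralRadius_lt_one D hD
  let q : Seminorm ℝ (ι → ℝ) := Seminorm.of
    (fun x => ∑ k ∈ Finset.range K, (ρ ^ k)⁻¹ * ‖(D ^ k).mulVec x‖)
    (fun x y => by
      rw [← Finset.sum_add_distrib]
      refine Finset.sum_le_sum fun k _ => ?_
      rw [← mul_add, Matrix.mulVec_add]
      exact mul_le_mul_of_nonneg_left (norm_add_le _ _) (by positivity))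
    (fun a x => by
      rw [Finset.mul_sum]
      refine Finset.sum_congr rfl fun k _ => ?_
      rw [Matrix.mulVec_smul, norm_smul]
      ring)
  have hq : ∀ x, q x = ∑ k ∈ Finset.range K, (ρ ^ k)⁻¹ * ‖(D ^ k).mulVec x‖ := fun _ => rfl
  refine ⟨q, ρ, ∑ k ∈ Finset.range K, (ρ ^ k)⁻¹ * ‖D ^ k‖, hρ, hρ1, by positivity,
    fun x => ?_, fun x => ?_, fun x => ?_⟩
  · rw [hq]
    have := Finset.single_le_sum (f := fun k => (ρ ^ k)⁻¹ * ‖(D ^ k).mulVec x‖)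
      (fun k _ => by positivity) (Finset.mem_range.2 hK)
    simpa using this
  · rw [hq, Finset.sum_mul]
    refine Finset.sum_le_sum fun k _ => ?_
    rw [mul_assoc]
    exact mul_le_mul_of_nonneg_left (Matrix.linfty_opNorm_mulVec _ _) (by positivity)
  · rw [hq, hq]
    -- the sum for `D x` is `ρ` times the sum for `x` with its indices shifted by one
    have h1 : ∑ k ∈ Finset.range K, (ρ ^ k)⁻¹ * ‖(D ^ k).mulVec (D.mulVec x)‖ =
        ρ * ∑ k ∈ Finset.range K, (ρ ^ (k + 1))⁻¹ * ‖(D ^ (k + 1)).mulVec x‖ := by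
      rw [Finset.mul_sum]
      refine Finset.sum_congr rfl fun k _ => ?_
      rw [Matrix.mulVec_mulVec, ← pow_succ, pow_succ ρ]
      field_simp
    rw [h1]
    refine mul_le_mul_of_nonneg_left ?_ hρ.le
    have h2 := Finset.sum_range_succ (fun k => (ρ ^ k)⁻¹ * ‖(D ^ k).mulVec x‖) K
    rw [Finset.sum_range_succ'] at h2
    have h3 : (ρ ^ K)⁻¹ * ‖(D ^ K).mulVec x‖ ≤ ‖x‖ := by
      rw [inv_mul_le_iff₀ (by positivity)]
      exact (Matrix.linfty_opNorm_mulVec _ _).trans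
        (mul_le_mul_of_nonneg_right hDK (norm_nonneg _))
    simp only [pow_zero, inv_one, one_mul, Matrix.one_mulVec] at h2
    linarith

end AdaptedSeminorm

variable {s : ℕ}

/-! ### The stage system and one Runge-Kutta step -/

theorem abs_sum_mul_le {ι : Type*} [Fintype ι] {a K : ℝ} (w x : ι → ℝ) (hw : ∑ j, |w j| ≤ a)
    (hK : 0 ≤ K) (hx : ∀ j, |x j| ≤ K) : |∑ j, w j * x j| ≤ a * K := by
  calc |∑ j, w j * x j| ≤ ∑ j, |w j| * K := by
        refine (Finset.abs_sum_le_sum_abs _ _).trans (Finset.sum_le_sum fun j _ => ?_)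
        rw [abs_mul]
        exact mul_le_mul_of_nonneg_left (hx j) (abs_nonneg _)
    _ ≤ a * K := by
        rw [← Finset.sum_mul]
        exact mul_le_mul_of_nonneg_right hw hK

/-- A priori bound for the stage system with a stage-dependent right hand side `d`. -/
theorem Method.norm_le_of_stage_eq (P : Method s) {a B h K : ℝ} {g x d : Fin s → ℝ}
    (ha : ∀ i, ∑ j, |P.A i j| ≤ a) (hh : 0 ≤ h) (hB : 0 ≤ B)
    (hg : ∀ j, |g j| ≤ B) (hsmall : h * (a * B) ≤ 1 / 2) (hK : 0 ≤ K) (hd : ∀ i, |d i| ≤ K)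
    (hx : ∀ i, x i = d i + h * ∑ j, P.A i j * (g j * x j)) : ‖x‖ ≤ 2 * K := by
  have h1 : ‖x‖ ≤ K + 1 / 2 * ‖x‖ := by
    refine (pi_norm_le_iff_of_nonneg (by positivity)).2 fun i => ?_
    rw [Real.norm_eq_abs, hx i]
    refine (abs_add_le _ _).trans (add_le_add (hd i) ?_)
    rw [abs_mul, abs_of_nonneg hh]
    have h2 : |∑ j, P.A i j * (g j * x j)| ≤ a * (B * ‖x‖) := by
      refine abs_sum_mul_le _ _ (ha i) (by positivity) fun j => ?_
      rw [abs_mul]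
      exact mul_le_mul (hg j) (norm_le_pi_norm x j) (abs_nonneg _) hB
    calc h * |∑ j, P.A i j * (g j * x j)| ≤ h * (a * (B * ‖x‖)) := by gcongr
      _ = h * (a * B) * ‖x‖ := by ring
      _ ≤ _ := by gcongr
  linarith

theorem Method.existsUnique_isStageSolution (P : Method s) {a B h v : ℝ} {g : Fin s → ℝ}
    (ha : ∀ i, ∑ j, |P.A i j| ≤ a) (hh : 0 ≤ h) (hB : 0 ≤ B)
    (hg : ∀ j, |g j| ≤ B) (hsmall : h * (a * B) ≤ 1 / 2) :
    ∃! U : Fin s → ℝ, P.IsStageSolution h v g U := by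
  let S : (Fin s → ℝ) →ₗ[ℝ] (Fin s → ℝ) :=
    LinearMap.id - h • (Matrix.of fun i j => P.A i j * g j).mulVecLin
  have hS : ∀ U i, S U i = U i - h * ∑ j, P.A i j * g j * U j := fun U i => by
    simp [S, Matrix.mulVec, dotProduct]
  have hinj : Function.Injective S := by
    refine (injective_iff_map_eq_zero S).2 fun x hx => ?_
    have := P.norm_le_of_stage_eq (x := x) (d := 0) ha hh hB hg hsmall le_rfl (by simp)
      (fun i => by
        have := congrFun hx i
        rw [hS] at this
        simp only [Pi.zero_apply, ← mul_assoc] at this ⊢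
        linarith)
    exact norm_le_zero_iff.1 (by simpa using this)
  have hiff : ∀ U, P.IsStageSolution h v g U ↔ S U = fun _ => v := fun U => by
    simp only [funext_iff, hS, Method.IsStageSolution, sub_eq_iff_eq_add]
  obtain ⟨U, hU⟩ := (LinearMap.injective_iff_surjective.1 hinj) fun _ => v
  exact ⟨U, (hiff U).2 hU, fun W hW => hinj (((hiff W).1 hW).trans hU.symm)⟩

/-- One step of the method moves the numerical value by `O(h)`. -/
theorem Method.abs_sum_stage_le (P : Method s) {a B h v : ℝ} {g U : Fin s → ℝ}
    (ha : ∀ i, ∑ j, |P.A i j| ≤ a) (hb : ∑ j, |P.b j| ≤ a) (hh : 0 ≤ h) (hB : 0 ≤ B)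
    (hg : ∀ j, |g j| ≤ B) (hsmall : h * (a * B) ≤ 1 / 2) (hU : P.IsStageSolution h v g U) :
    |h * ∑ i, P.b i * g i * U i| ≤ h * (a * (B * (2 * |v|))) := by
  have h1 := P.norm_le_of_stage_eq (x := U) (d := fun _ => v) ha hh hB hg hsmall (abs_nonneg v)
    (fun _ => le_rfl) (fun i => by simpa only [mul_assoc] using hU i)
  rw [abs_mul, abs_of_nonneg hh]
  simp only [mul_assoc]
  refine mul_le_mul_of_nonneg_left (abs_sum_mul_le _ _ hb (by positivity) fun j => ?_) hh
  rw [abs_mul]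
  exact mul_le_mul (hg j) ((norm_le_pi_norm U j).trans h1) (abs_nonneg _) hB

/-- Error propagation of one Runge-Kutta step. Here `x₀`, `X i`, `x₁` are exact values at the
beginning, at the stages and at the end of the step, `G` are the exact values replaced by `g` in
the method, and `κ` bounds the defects. -/
theorem Method.abs_step_error_le (P : Method s) {a B h v κ Um η x₀ x₁ : ℝ}
    {g U G X : Fin s → ℝ}
    (ha : ∀ i, ∑ j, |P.A i j| ≤ a) (hb : ∑ j, |P.b j| ≤ a) (ha0 : 0 ≤ a) (hh : 0 ≤ h)
    (hB : 0 ≤ B) (hUm : 0 ≤ Um) (hκ : 0 ≤ κ) (hη : 0 ≤ η)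
    (hg : ∀ j, |g j| ≤ B) (hX : ∀ j, |X j| ≤ Um) (hG : ∀ j, |G j - g j| ≤ η)
    (hsmall : h * (a * B) ≤ 1 / 2) (hU : P.IsStageSolution h v g U)
    (hdef : ∀ i, |X i - x₀ - h * ∑ j, P.A i j * (G j * X j)| ≤ κ)
    (hdef' : |x₁ - x₀ - h * ∑ j, P.b j * (G j * X j)| ≤ κ) :
    |x₁ - (v + h * ∑ i, P.b i * g i * U i)| ≤
      (1 + 2 * (a * B) * h) * |x₀ - v| + 2 * (a * Um) * h * η + 2 * κ := by
  -- the error of the product splits as `G X - g U = g (X - U) + (G - g) X`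
  have hsplit : ∀ w : Fin s → ℝ, ∑ j, w j * (G j * X j) =
      ∑ j, w j * (g j * U j) + ∑ j, w j * (g j * (X - U) j) +
        ∑ j, w j * ((G j - g j) * X j) := fun w => by
    rw [← Finset.sum_add_distrib, ← Finset.sum_add_distrib]
    refine Finset.sum_congr rfl fun j _ => ?_
    simp only [Pi.sub_apply]
    ring
  have hsrc : ∀ w : Fin s → ℝ, ∑ j, |w j| ≤ a →
      |h * ∑ j, w j * ((G j - g j) * X j)| ≤ h * (a * (η * Um)) := fun w hw => by
    rw [abs_mul, abs_of_nonneg hh]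
    refine mul_le_mul_of_nonneg_left (abs_sum_mul_le _ _ hw (by positivity) fun j => ?_) hh
    rw [abs_mul]
    exact mul_le_mul (hG j) (hX j) (abs_nonneg _) hη
  have hstage : ‖X - U‖ ≤ 2 * (|x₀ - v| + h * (a * (η * Um)) + κ) := by
    refine P.norm_le_of_stage_eq (x := X - U)
      (d := fun i => (x₀ - v) + h * ∑ j, P.A i j * ((G j - g j) * X j) +
        (X i - x₀ - h * ∑ j, P.A i j * (G j * X j))) ha hh hB hg hsmall (by positivity)
      (fun i => ?_) fun i => ?_
    · exact (abs_add_three _ _ _).trans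
        (add_le_add (add_le_add le_rfl (hsrc _ (ha i))) (hdef i))
    · have := hU i
      simp only [mul_assoc] at this
      rw [hsplit, Pi.sub_apply, this]
      ring
  have hmain : |h * ∑ j, P.b j * (g j * (X - U) j)| ≤
      h * (a * (B * (2 * (|x₀ - v| + h * (a * (η * Um)) + κ)))) := by
    rw [abs_mul, abs_of_nonneg hh]
    refine mul_le_mul_of_nonneg_left (abs_sum_mul_le _ _ hb (by positivity) fun j => ?_) hh
    rw [abs_mul]
    exact mul_le_mul (hg j) ((norm_le_pi_norm (X - U) j).trans hstage) (abs_nonneg _) hB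
  have heq : x₁ - (v + h * ∑ i, P.b i * g i * U i) =
      (x₀ - v) + h * ∑ j, P.b j * (g j * (X - U) j) + h * ∑ j, P.b j * ((G j - g j) * X j) +
        (x₁ - x₀ - h * ∑ j, P.b j * (G j * X j)) := by
    rw [hsplit]
    simp only [mul_assoc]
    ring
  rw [heq]
  have htri := abs_add_three ((x₀ - v) + h * ∑ j, P.b j * (g j * (X - U) j))
    (h * ∑ j, P.b j * ((G j - g j) * X j)) (x₁ - x₀ - h * ∑ j, P.b j * (G j * X j))
  have htri' := abs_add_le (x₀ - v) (h * ∑ j, P.b j * (g j * (X - U) j))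
  have hs := hsrc P.b hb
  have hp : h * (a * B) * (h * (a * (η * Um)) + κ) ≤ 1 / 2 * (h * (a * (η * Um)) + κ) :=
    mul_le_mul_of_nonneg_right hsmall (by positivity)
  linarith

/-! ### Polynomial approximation and defects -/

/-- Taylor's formula with a remainder that is uniform in the base point `a`, on a compact
interval inside an open set. By induction on the order: integrate the expansion of `deriv f`. -/
theorem exists_uniform_taylor {I : Set ℝ} (hI : IsOpen I) {α β : ℝ} (hJ : Icc α β ⊆ I) (s : ℕ) :
    ∀ {f : ℝ → ℝ}, ContDiffOn ℝ s f I → ∃ K, 0 ≤ K ∧ ∀ a ∈ Icc α β, ∃ p : ℕ → ℝ,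
      ∀ x ∈ Icc α β, |f x - ∑ k ∈ Finset.range s, p k * (x - a) ^ k| ≤ K * |x - a| ^ s := by
  induction s with
  | zero =>
    intro f hf
    obtain ⟨K, hK⟩ := isCompact_Icc.exists_bound_of_continuousOn (hf.continuousOn.mono hJ)
    refine ⟨max K 0, le_max_right _ _, fun a _ => ⟨0, fun x hx => ?_⟩⟩
    simpa using Or.inl (hK x hx)
  | succ s ih =>
    intro f hf
    push_cast at hf
    obtain ⟨hd, -, hf'⟩ := (contDiffOn_succ_iff_deriv_of_isOpen hI).1 hf
    obtain ⟨K, hK0, hK⟩ := ih hf'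
    refine ⟨K, hK0, fun a ha => ?_⟩
    obtain ⟨p, hp⟩ := hK a ha
    refine ⟨fun k => if k = 0 then f a else p (k - 1) / k, fun x hx => ?_⟩
    have hsub : uIcc a x ⊆ Icc α β := uIcc_subset_Icc ha hx
    have hderiv : ∀ y ∈ uIcc a x, HasDerivWithinAt
        (fun y => f y - ∑ k ∈ Finset.range s, p k / (k + 1) * (y - a) ^ (k + 1))
        (deriv f y - ∑ k ∈ Finset.range s, p k * (y - a) ^ k) (uIcc a x) y := fun y hy => by
      have h1 : HasDerivAt f (deriv f y) y :=
        ((hd y (hJ (hsub hy))).differentiableAt (hI.mem_nhds (hJ (hsub hy)))).hasDerivAt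
      refine (h1.sub (HasDerivAt.fun_sum fun k _ => ?_)).hasDerivWithinAt
      have h2 := (((hasDerivAt_id y).sub_const a).pow (k + 1)).const_mul (p k / (k + 1))
      refine h2.congr_deriv ?_
      have : (k + 1 : ℝ) ≠ 0 := by positivity
      simp only [id, Nat.add_sub_cancel, mul_one]
      push_cast
      field_simp
    have hbound : ∀ y ∈ uIcc a x,
        ‖deriv f y - ∑ k ∈ Finset.range s, p k * (y - a) ^ k‖ ≤ K * |x - a| ^ s := fun y hy => by
      exact (hp y (hsub hy)).trans (mul_le_mul_of_nonneg_left
        (pow_le_pow_left₀ (abs_nonneg _) (abs_sub_left_of_mem_uIcc hy) _) hK0)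
    have key := (convex_uIcc a x).norm_image_sub_le_of_norm_hasDerivWithin_le hderiv hbound
      left_mem_uIcc right_mem_uIcc
    rw [Finset.sum_range_succ']
    simp only [Real.norm_eq_abs, sub_self, ne_eq, Nat.add_eq_zero_iff, one_ne_zero, and_false,
      not_false_eq_true, zero_pow, mul_zero, Finset.sum_const_zero, sub_zero] at key
    simp only [Nat.add_eq_zero_iff, one_ne_zero, and_false, if_false, if_true, pow_zero, mul_one,
      Nat.add_sub_cancel, Nat.cast_add, Nat.cast_one]
    calc _ = |f x - ∑ k ∈ Finset.range s, p k / (k + 1) * (x - a) ^ (k + 1) - f a| := by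
          congr 1; ring
      _ ≤ _ := key
      _ = _ := by ring

/-- The quadrature rule with weights `∫₀ˣ ℓ j` integrates monomials of degree less than the
number of nodes exactly. -/
theorem sum_integral_basis_mul_pow {c w : Fin s → ℝ} (hc : Function.Injective c) {x : ℝ}
    (hw : ∀ j, w j = ∫ τ in (0 : ℝ)..x, (Lagrange.basis Finset.univ c j).eval τ)
    {k : ℕ} (hk : k < s) : ∑ j, w j * c j ^ k = x ^ (k + 1) / (k + 1) := by
  have hX : (Polynomial.X ^ k : Polynomial ℝ) =
      Lagrange.interpolate Finset.univ c fun j => c j ^ k := by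
    refine Lagrange.eq_interpolate_of_eval_eq _ hc.injOn ?_ (by simp)
    rw [Polynomial.degree_X_pow]
    simpa using hk
  have h1 : ∀ τ : ℝ,
      τ ^ k = ∑ j, (Lagrange.basis Finset.univ c j).eval τ * c j ^ k := fun τ => by
    have := congrArg (Polynomial.eval τ) hX
    rw [Lagrange.interpolate_apply, Polynomial.eval_finsetSum] at this
    simpa [mul_comm] using this
  have h2 : ∫ τ in (0 : ℝ)..x, τ ^ k = x ^ (k + 1) / (k + 1) := by simp
  rw [← h2, intervalIntegral.integral_congr fun τ _ => h1 τ, intervalIntegral.integral_finsetSum]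
  · refine Finset.sum_congr rfl fun j _ => ?_
    rw [hw, intervalIntegral.integral_mul_const]
  · intro j _
    exact ((Polynomial.continuous _).mul continuous_const).intervalIntegrable _ _

/-- Defect of a rule with `w j = ∫₀ˣ ℓ j` for `u (t + x h) - u t = ∫ f`, when `f` is within `δ`
of a polynomial of degree less than the number of nodes. -/
theorem abs_collocation_defect_le {c w : Fin s → ℝ} (hc : Function.Injective c)
    (hc01 : ∀ j, c j ∈ Icc (0 : ℝ) 1) {x : ℝ} (hx : x ∈ Icc (0 : ℝ) 1)
    (hw : ∀ j, w j = ∫ τ in (0 : ℝ)..x, (Lagrange.basis Finset.univ c j).eval τ)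
    {a δ h t : ℝ} (ha : ∑ j, |w j| ≤ a) (hδ : 0 ≤ δ) (hh : 0 ≤ h) {u f : ℝ → ℝ} {p : ℕ → ℝ}
    (hu : ∀ y ∈ Icc 0 h, HasDerivAt u (f (t + y)) (t + y))
    (hf : ∀ y ∈ Icc 0 h, |f (t + y) - ∑ k ∈ Finset.range s, p k * y ^ k| ≤ δ) :
    |u (t + x * h) - u t - h * ∑ j, w j * f (t + c j * h)| ≤ (1 + a) * (h * δ) := by
  have hmem : ∀ {y}, y ∈ Icc (0 : ℝ) 1 → y * h ∈ Icc 0 h := fun hy =>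
    ⟨mul_nonneg hy.1 hh, mul_le_of_le_one_left hh hy.2⟩
  have hderiv : ∀ y ∈ Icc 0 h, HasDerivWithinAt
      (fun y => u (t + y) - ∑ k ∈ Finset.range s, p k / (k + 1) * y ^ (k + 1))
      (f (t + y) - ∑ k ∈ Finset.range s, p k * y ^ k) (Icc 0 h) y := fun y hy => by
    refine (((hu y hy).comp_const_add t y).sub
      (HasDerivAt.fun_sum fun k _ => ?_)).hasDerivWithinAt
    have h2 := ((hasDerivAt_id y).pow (k + 1)).const_mul (p k / (k + 1))
    refine h2.congr_deriv ?_
    have : (k + 1 : ℝ) ≠ 0 := by positivity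
    simp only [id, Nat.add_sub_cancel, mul_one]
    push_cast
    field_simp
  have key := (convex_Icc 0 h).norm_image_sub_le_of_norm_hasDerivWithin_le hderiv
    (fun y hy => hf y hy) (left_mem_Icc.2 hh) (hmem hx)
  simp only [Real.norm_eq_abs, add_zero, sub_zero, ne_eq, Nat.add_eq_zero_iff, one_ne_zero,
    and_false, not_false_eq_true, zero_pow, mul_zero, Finset.sum_const_zero] at key
  have hexact : ∑ k ∈ Finset.range s, p k / (k + 1) * (x * h) ^ (k + 1) =
      h * ∑ j, w j * ∑ k ∈ Finset.range s, p k * (c j * h) ^ k := by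
    simp only [Finset.mul_sum]
    rw [Finset.sum_comm]
    refine Finset.sum_congr rfl fun k hk => ?_
    have hm := sum_integral_basis_mul_pow hc hw (Finset.mem_range.1 hk)
    calc _ = h ^ (k + 1) * p k * (x ^ (k + 1) / (k + 1)) := by rw [mul_pow]; ring
      _ = _ := by
        rw [← hm, Finset.mul_sum]
        refine Finset.sum_congr rfl fun j _ => ?_
        rw [mul_pow]; ring
  have hquad := abs_sum_mul_le w
    (fun j => f (t + c j * h) - ∑ k ∈ Finset.range s, p k * (c j * h) ^ k) ha hδ
    fun j => hf _ (hmem (hc01 j))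
  have h1 : |u (t + x * h) - ∑ k ∈ Finset.range s, p k / (k + 1) * (x * h) ^ (k + 1) - u t| ≤
      h * δ := by
    refine key.trans ?_
    rw [abs_of_nonneg (hmem hx).1, mul_comm]
    exact mul_le_mul_of_nonneg_right (hmem hx).2 hδ
  have heq : u (t + x * h) - u t - h * ∑ j, w j * f (t + c j * h) =
      (u (t + x * h) - ∑ k ∈ Finset.range s, p k / (k + 1) * (x * h) ^ (k + 1) - u t) -
      h * ∑ j, w j * (f (t + c j * h) - ∑ k ∈ Finset.range s, p k * (c j * h) ^ k) := by
    rw [hexact]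
    simp only [mul_sub, Finset.sum_sub_distrib]
    ring
  rw [heq]
  refine (abs_sub _ _).trans ?_
  rw [abs_mul h, abs_of_nonneg hh]
  have := mul_le_mul_of_nonneg_left hquad hh
  linarith

/-- The consistency relation for monomials, read off at `h = 1`. -/
theorem Method.IsConsistent.pow_eq {P : Method s} (hP : P.IsConsistent) (i : Fin s) {k : ℕ}
    (hk : k < s) :
    P.c i ^ k = ∑ j, P.D i j * (P.c j - 1) ^ k + if k = 0 then P.θ i else 0 := by
  have := congrFun (congrFun (hP 1 one_pos) i) ⟨k, hk⟩
  simpa [Matrix.mul_apply, Method.Theta, Matrix.vandermonde_apply] using this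

/-- Defect of the auxiliary step for a function within `δ` of a polynomial of degree less
than `s`. -/
theorem Method.IsConsistent.abs_defect_le {P : Method s} (hP : P.IsConsistent) (hs : 0 < s)
    (hc01 : ∀ j, P.c j ∈ Icc (0 : ℝ) 1) {a δ h t : ℝ} (hδ : 0 ≤ δ) (hh : 0 ≤ h) {g : ℝ → ℝ}
    {p : ℕ → ℝ} (i : Fin s) (ha : ∑ j, |P.D i j| + |P.θ i| ≤ a)
    (hg : ∀ y ∈ Icc (-h) h, |g (t + y) - ∑ k ∈ Finset.range s, p k * y ^ k| ≤ δ) :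
    |g (t + P.c i * h) - ∑ j, P.D i j * g (t + (P.c j - 1) * h) - P.θ i * g t| ≤
      (1 + a) * δ := by
  have hpoly : ∑ k ∈ Finset.range s, p k * (P.c i * h) ^ k =
      ∑ j, P.D i j * (∑ k ∈ Finset.range s, p k * ((P.c j - 1) * h) ^ k) + P.θ i * p 0 := by
    have h0 : P.θ i * p 0 =
        ∑ k ∈ Finset.range s, p k * h ^ k * if k = 0 then P.θ i else 0 := by
      simp [hs, mul_comm]
    simp only [Finset.mul_sum]
    rw [h0, Finset.sum_comm, ← Finset.sum_add_distrib]
    refine Finset.sum_congr rfl fun k hk => ?_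
    rw [mul_pow, hP.pow_eq i (Finset.mem_range.1 hk), add_mul, mul_add, Finset.sum_mul,
      Finset.mul_sum]
    congr 1
    · refine Finset.sum_congr rfl fun j _ => ?_
      rw [mul_pow]; ring
    · ring
  have hmem : ∀ j, P.c j * h ∈ Icc (-h) h ∧ (P.c j - 1) * h ∈ Icc (-h) h := fun j => by
    have h1 := mul_nonneg (hc01 j).1 hh
    have h2 := mul_le_of_le_one_left hh (hc01 j).2
    exact ⟨⟨by linarith, by linarith⟩, ⟨by linarith, by linarith⟩⟩
  have e0 : |g t - p 0| ≤ δ := by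
    have := hg 0 ⟨by linarith, hh⟩
    rwa [add_zero, Finset.sum_eq_single_of_mem 0 (Finset.mem_range.2 hs)
      (fun k _ hk => by simp [hk]), pow_zero, mul_one] at this
  have hquad := abs_sum_mul_le (P.D i)
    (fun j => g (t + (P.c j - 1) * h) - ∑ k ∈ Finset.range s, p k * ((P.c j - 1) * h) ^ k)
    (le_refl _) hδ fun j => hg _ (hmem j).2
  have heq : g (t + P.c i * h) - ∑ j, P.D i j * g (t + (P.c j - 1) * h) - P.θ i * g t =
      (g (t + P.c i * h) - ∑ k ∈ Finset.range s, p k * (P.c i * h) ^ k) -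
      ∑ j, P.D i j * (g (t + (P.c j - 1) * h) -
        ∑ k ∈ Finset.range s, p k * ((P.c j - 1) * h) ^ k) - P.θ i * (g t - p 0) := by
    rw [hpoly]
    simp only [mul_sub, Finset.sum_sub_distrib]
    ring
  rw [heq]
  refine (abs_sub _ _).trans ((add_le_add_left (abs_sub _ _) _).trans ?_)
  rw [abs_mul (P.θ i)]
  have h1 := hg _ (hmem i).1
  have h2 := mul_le_mul_of_nonneg_left e0 (abs_nonneg (P.θ i))
  have h3 := mul_le_mul_of_nonneg_right ha hδ
  linarith

/-! ### Regularity of the exact solution -/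

theorem isOpen_setOf_between (Tlo Thi : EReal) :
    IsOpen {t : ℝ | Tlo < t ∧ (t : EReal) < Thi} :=
  (isOpen_Ioo (a := Tlo) (b := Thi)).preimage continuous_coe_real_ereal

/-- A solution of `u' = N(u) u` is as smooth as `N`. -/
theorem IsSolutionOn.contDiffOn {N : ℝ → ℝ} {Ω : Set ℝ} {x₀ : ℝ} {u : ℝ → ℝ} {Tlo Thi : EReal}
    (hu : IsSolutionOn N Ω x₀ u Tlo Thi) (hN : ContDiffOn ℝ s N Ω) :
    ContDiffOn ℝ s u {t : ℝ | Tlo < t ∧ (t : EReal) < Thi} := by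
  have hI := isOpen_setOf_between Tlo Thi
  suffices H : ∀ k : ℕ, k ≤ s → ContDiffOn ℝ k u {t : ℝ | Tlo < t ∧ (t : EReal) < Thi} from
    H s le_rfl
  intro k
  induction k with
  | zero =>
    intro _
    exact contDiffOn_zero.2 fun t ht => (hu.deriv t ht.1 ht.2).continuousAt.continuousWithinAt
  | succ k ih =>
    intro hk
    have huk := ih (by omega)
    have hNk : ContDiffOn ℝ k N Ω := hN.of_le (by exact_mod_cast (by omega : k ≤ s))
    push_cast
    refine (contDiffOn_succ_iff_deriv_of_isOpen hI).2
      ⟨fun t ht => (hu.deriv t ht.1 ht.2).differentiableAt.differentiableWithinAt, by simp, ?_⟩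
    exact ((hNk.comp huk fun t ht => hu.mem t ht.1 ht.2).mul huk).congr fun t ht =>
      (hu.deriv t ht.1 ht.2).deriv

theorem isCompact_tube {u : ℝ → ℝ} {T : ℝ} (hu : ContinuousOn u (Icc 0 T)) (r : ℝ) :
    IsCompact (tube u T r) := by
  have h1 : tube u T r = (fun x : ℝ × ℝ => u x.1 + x.2) '' (Icc 0 T ×ˢ Icc (-r) r) := by
    ext x
    constructor
    · rintro ⟨t, ht, v, hv, rfl⟩
      exact ⟨(t, v), ⟨ht, abs_le.1 hv⟩, rfl⟩
    · rintro ⟨⟨t, v⟩, ⟨ht, hv⟩, rfl⟩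
      exact ⟨t, ht, v, abs_le.2 hv, rfl⟩
  rw [h1]
  refine (isCompact_Icc.prod isCompact_Icc).image_of_continuousOn ?_
  exact (hu.comp continuousOn_fst fun x hx => hx.1).add continuousOn_snd

/-- `N` is Lipschitz along the fibres of the tube, uniformly in `t`. -/
theorem exists_lipschitz_on_tube {N u : ℝ → ℝ} {Ω : Set ℝ} (hΩ : IsOpen Ω)
    (hN : ContDiffOn ℝ 1 N Ω) {T r : ℝ} (hu : ContinuousOn u (Icc 0 T)) (hr : 0 ≤ r)
    (hV : tube u T r ⊆ Ω) :
    ∃ L, 0 ≤ L ∧ ∀ t ∈ Icc 0 T, ∀ x, |u t - x| ≤ r → |N (u t) - N x| ≤ L * |u t - x| := by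
  obtain ⟨L, hL⟩ := (isCompact_tube hu r).exists_bound_of_continuousOn
    ((hN.continuousOn_deriv_of_isOpen hΩ le_rfl).mono hV)
  refine ⟨max L 0, le_max_right _ _, fun t ht x hx => ?_⟩
  have hsub : Metric.closedBall (u t) r ⊆ tube u T r := fun y hy =>
    ⟨t, ht, y - u t, by simpa [Real.dist_eq] using hy, by ring⟩
  refine (convex_closedBall (u t) r).norm_image_sub_le_of_norm_deriv_le (𝕜 := ℝ) (fun y hy => ?_)
    (fun y hy => (hL y (hsub hy)).trans (le_max_left _ _)) ?_ (Metric.mem_closedBall_self hr)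
  · exact ((hN.differentiableOn one_ne_zero) y (hV (hsub hy))).differentiableAt
      (hΩ.mem_nhds (hV (hsub hy)))
  · rwa [Metric.mem_closedBall, dist_comm, Real.dist_eq]

/-! ### Defects of the exact solution -/

theorem Method.exists_coeff_bound (P : Method s) :
    ∃ a, 0 ≤ a ∧ (∀ i, ∑ j, |P.A i j| ≤ a) ∧ ∑ j, |P.b j| ≤ a ∧
      ∀ i, ∑ j, |P.D i j| + |P.θ i| ≤ a := by
  have hA : ∀ i, ∑ j, |P.A i j| ≤ ∑ i, ∑ j, |P.A i j| := fun i =>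
    Finset.single_le_sum (f := fun i => ∑ j, |P.A i j|) (fun i _ => by positivity)
      (Finset.mem_univ i)
  have hD : ∀ i, ∑ j, |P.D i j| + |P.θ i| ≤ ∑ i, (∑ j, |P.D i j| + |P.θ i|) := fun i =>
    Finset.single_le_sum (f := fun i => ∑ j, |P.D i j| + |P.θ i|) (fun i _ => by positivity)
      (Finset.mem_univ i)
  have h1 : 0 ≤ ∑ i, ∑ j, |P.A i j| := by positivity
  have h2 : 0 ≤ ∑ j, |P.b j| := by positivity
  have h3 : 0 ≤ ∑ i, (∑ j, |P.D i j| + |P.θ i|) := by positivity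
  exact ⟨∑ i, ∑ j, |P.A i j| + ∑ j, |P.b j| + ∑ i, (∑ j, |P.D i j| + |P.θ i|), by positivity,
    fun i => by linarith [hA i], by linarith, fun i => by linarith [hD i]⟩

/-- The defects of the exact solution in the auxiliary step, the stages and the final update,
uniformly over steps starting in `[0, T]`. -/
theorem exists_defect_bound (hs : 1 ≤ s) {P : Method s} (hcoll : P.IsCollocation)
    (hcons : P.IsConsistent) {N : ℝ → ℝ} {Ω : Set ℝ} (hN : ContDiffOn ℝ s N Ω) {x₀ : ℝ}
    {u : ℝ → ℝ} {Tlo Thi : EReal} (hu : IsSolutionOn N Ω x₀ u Tlo Thi) {T h₁ : ℝ}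
    (hJ : Icc (-h₁) (T + h₁) ⊆ {t : ℝ | Tlo < t ∧ (t : EReal) < Thi}) :
    ∃ K, 0 ≤ K ∧ ∀ h, 0 ≤ h → h ≤ h₁ → ∀ t ∈ Icc 0 T,
      (∀ i, |N (u (t + P.c i * h)) - ∑ j, P.D i j * N (u (t + (P.c j - 1) * h)) -
        P.θ i * N (u t)| ≤ K * h ^ s) ∧
      (∀ i, |u (t + P.c i * h) - u t -
        h * ∑ j, P.A i j * (N (u (t + P.c j * h)) * u (t + P.c j * h))| ≤ K * (h * h ^ s)) ∧
      |u (t + h) - u t -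
        h * ∑ j, P.b j * (N (u (t + P.c j * h)) * u (t + P.c j * h))| ≤ K * (h * h ^ s) := by
  have hI := isOpen_setOf_between Tlo Thi
  have hus := hu.contDiffOn hN
  have hg : ContDiffOn ℝ s (fun t => N (u t)) {t : ℝ | Tlo < t ∧ (t : EReal) < Thi} :=
    hN.comp hus fun t ht => hu.mem t ht.1 ht.2
  obtain ⟨a, ha, hA, hb, hD⟩ := P.exists_coeff_bound
  obtain ⟨K₁, hK₁, H₁⟩ := exists_uniform_taylor hI hJ s hg
  obtain ⟨K₂, hK₂, H₂⟩ := exists_uniform_taylor hI hJ s (hg.mul hus)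
  refine ⟨(1 + a) * (K₁ + K₂), by positivity, fun h hh hh1 t ht => ?_⟩
  have hmem : ∀ y ∈ Icc (-h) h, t + y ∈ Icc (-h₁) (T + h₁) := fun y hy =>
    ⟨by linarith [hy.1, ht.1], by linarith [hy.2, ht.2]⟩
  have htmem : t ∈ Icc (-h₁) (T + h₁) := ⟨by linarith [ht.1], by linarith [ht.2]⟩
  have htay : ∀ {f : ℝ → ℝ} {p : ℕ → ℝ} {K : ℝ}, 0 ≤ K → (∀ x ∈ Icc (-h₁) (T + h₁),
      |f x - ∑ k ∈ Finset.range s, p k * (x - t) ^ k| ≤ K * |x - t| ^ s) →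
      ∀ y ∈ Icc (-h) h, |f (t + y) - ∑ k ∈ Finset.range s, p k * y ^ k| ≤ K * h ^ s := by
    intro f p K hK H y hy
    have := H _ (hmem y hy)
    rw [add_sub_cancel_left] at this
    exact this.trans (mul_le_mul_of_nonneg_left
      (pow_le_pow_left₀ (abs_nonneg _) (abs_le.2 hy) _) hK)
  obtain ⟨p₁, hp₁⟩ := H₁ t htmem
  obtain ⟨p₂, hp₂⟩ := H₂ t htmem
  have hhs : 0 ≤ h ^ s := by positivity
  have hder : ∀ y ∈ Icc 0 h, HasDerivAt u (N (u (t + y)) * u (t + y)) (t + y) := fun y hy => by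
    have := hJ (hmem y ⟨by linarith [hy.1], hy.2⟩)
    exact hu.deriv _ this.1 this.2
  have hf : ∀ y ∈ Icc 0 h, |N (u (t + y)) * u (t + y) - ∑ k ∈ Finset.range s, p₂ k * y ^ k| ≤
      K₂ * h ^ s := fun y hy => htay hK₂ hp₂ y ⟨by linarith [hy.1], hy.2⟩
  have hle₁ : (1 + a) * (K₁ * h ^ s) ≤ (1 + a) * (K₁ + K₂) * h ^ s := by
    rw [mul_assoc]
    gcongr
    linarith
  have hle₂ : (1 + a) * (h * (K₂ * h ^ s)) ≤ (1 + a) * (K₁ + K₂) * (h * h ^ s) := by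
    rw [mul_left_comm h, mul_assoc]
    gcongr
    linarith
  refine ⟨fun i => ?_, fun i => ?_, ?_⟩
  · exact (hcons.abs_defect_le hs hcoll.mem_Icc (mul_nonneg hK₁ hhs) hh (g := fun t => N (u t))
      i (hD i) (htay hK₁ hp₁)).trans hle₁
  · exact (abs_collocation_defect_le hcoll.strictMono.injective hcoll.mem_Icc (hcoll.mem_Icc i)
      (hcoll.A_eq i) (hA i) (mul_nonneg hK₂ hhs) hh (f := fun t => N (u t) * u t)
      hder hf).trans hle₂
  · have := (abs_collocation_defect_le hcoll.strictMono.injective hcoll.mem_Icc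
      (right_mem_Icc.2 zero_le_one) hcoll.b_eq hb (mul_nonneg hK₂ hhs) hh
      (f := fun t => N (u t) * u t) hder hf).trans hle₂
    simpa only [one_mul] using this

/-! ### Error recursion -/

/-- Propagation of the error of the auxiliary variables, in a seminorm contracted by `D`. -/
theorem Method.seminorm_nextGamma_error_le (P : Method s) {q : Seminorm ℝ (Fin s → ℝ)}
    {ρ κ : ℝ} (hκ : 0 ≤ κ) (hqκ : ∀ x, q x ≤ κ * ‖x‖)
    (hqD : ∀ x, q (P.D.mulVec x) ≤ ρ * q x) {N : ℝ → ℝ} {v y ε L δ : ℝ}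
    {G G' Γ : Fin s → ℝ} (hδ : 0 ≤ δ)
    (hL : |N y - N v| ≤ L * |y - v|) (hq : q (G - Γ) ≤ ε) (hρ : 0 ≤ ρ)
    (hdef : ∀ i, |G' i - ∑ j, P.D i j * G j - P.θ i * N y| ≤ δ) :
    q (G' - P.nextGamma N v Γ) ≤ ρ * ε + q P.θ * (L * |y - v|) + κ * δ := by
  set R : Fin s → ℝ := fun i => G' i - ∑ j, P.D i j * G j - P.θ i * N y with hR
  have heq : G' - P.nextGamma N v Γ = P.D.mulVec (G - Γ) + (N y - N v) • P.θ + R := by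
    funext i
    simp only [hR, Method.nextGamma, Matrix.mulVec_sub, Pi.sub_apply, Pi.add_apply,
      Pi.smul_apply, smul_eq_mul, Matrix.mulVec, dotProduct]
    ring
  rw [heq]
  have h1 : q R ≤ κ * δ := (hqκ R).trans (mul_le_mul_of_nonneg_left
    ((pi_norm_le_iff_of_nonneg hδ).2 hdef) hκ)
  have h2 : q ((N y - N v) • P.θ) ≤ q P.θ * (L * |y - v|) := by
    rw [map_smul_eq_mul, Real.norm_eq_abs, mul_comm]
    exact mul_le_mul_of_nonneg_left hL (apply_nonneg q _)
  have h3 := (hqD (G - Γ)).trans (mul_le_mul_of_nonneg_left hq hρ)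
  exact (map_add_le_add q _ _).trans (add_le_add ((map_add_le_add q _ _).trans
    (add_le_add h3 h2)) h1)

/-- The coupled error recursion. The weight `μ = c / (1 - ρ)` is chosen so that `y + μ h z` grows
by a factor `1 + O(h)` only; the a priori bounds `y n ≤ r` and `z (n + 1) ≤ β`, under which the
recursion is available, are recovered along the way. -/
theorem coupled_recursion_bound {y z : ℕ → ℝ} {ρ c h δ T r β Y Z μ c' : ℝ} (hρ : 0 ≤ ρ)
    (hρ1 : ρ < 1) (hc : 0 ≤ c) (hh : 0 ≤ h) (hδ : 0 ≤ δ) (hμ : μ = c / (1 - ρ))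
    (hc' : c' = c + (c + μ) * c) (hy0 : ∀ n, 0 ≤ y n) (hz0 : ∀ n, 0 ≤ z n)
    (hz : ∀ n : ℕ, n * h ≤ T → y n ≤ r → z (n + 1) ≤ ρ * z n + c * y n + c * δ)
    (hy : ∀ n : ℕ, n * h ≤ T → y n ≤ r → z (n + 1) ≤ β →
      y (n + 1) ≤ (1 + c * h) * y n + c * h * z (n + 1) + c * (h * δ))
    (hY : Y = Real.exp (c' * T) * (y 0 + μ * h * z 0 + δ)) (hYr : Y ≤ r)
    (hZ : Z = z 0 + μ * (Y + δ)) (hZβ : Z ≤ β) (n : ℕ) (hn : n * h ≤ T) :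
    y n + μ * h * z n + δ ≤ Real.exp (c' * (n * h)) * (y 0 + μ * h * z 0 + δ) ∧
      y n ≤ Y ∧ z n ≤ Z ∧ z (n + 1) ≤ Z := by
  have h1ρ : 0 < 1 - ρ := by linarith
  have hμ0 : 0 ≤ μ := hμ ▸ div_nonneg hc h1ρ.le
  have hμρ : μ * (1 - ρ) = c := by rw [hμ]; field_simp
  have hc'0 : 0 ≤ c' := by rw [hc']; positivity
  have hW0 : 0 ≤ y 0 + μ * h * z 0 + δ := by
    have := hy0 0
    have := hz0 0
    positivity
  have hY0 : 0 ≤ Y := hY ▸ mul_nonneg (Real.exp_pos _).le hW0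
  have hyY : ∀ n : ℕ, n * h ≤ T →
      y n + μ * h * z n + δ ≤ Real.exp (c' * (n * h)) * (y 0 + μ * h * z 0 + δ) → y n ≤ Y := by
    intro n hn hw
    have h1 : Real.exp (c' * (n * h)) * (y 0 + μ * h * z 0 + δ) ≤ Y := by
      rw [hY]
      gcongr
    have h2 : 0 ≤ μ * h * z n := by have := hz0 n; positivity
    linarith
  have hstep : ∀ n : ℕ, n * h ≤ T → y n ≤ Y → z n ≤ Z → z (n + 1) ≤ Z := by
    intro n hn hyn hzn
    have h1 := hz n hn (hyn.trans hYr)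
    have h2 : (1 - ρ) * Z = (1 - ρ) * z 0 + c * (Y + δ) := by
      rw [hZ, mul_add, ← mul_assoc, mul_comm (1 - ρ) μ, hμρ]
    have h3 := mul_le_mul_of_nonneg_left hyn hc
    have h4 := mul_le_mul_of_nonneg_left hzn hρ
    have h5 := mul_nonneg h1ρ.le (hz0 0)
    linarith
  suffices H : y n + μ * h * z n + δ ≤
      Real.exp (c' * (n * h)) * (y 0 + μ * h * z 0 + δ) ∧ z n ≤ Z by
    have hyn := hyY n hn H.1
    exact ⟨H.1, hyn, H.2, hstep n hn hyn H.2⟩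
  induction n with
  | zero =>
    refine ⟨by simp, ?_⟩
    have := mul_nonneg hμ0 (add_nonneg hY0 hδ)
    linarith
  | succ n ih =>
    have hn' : n * h ≤ T := by
      push_cast at hn
      linarith
    obtain ⟨hw, hzn⟩ := ih hn'
    have hyn := hyY n hn' hw
    have hzn1 := hstep n hn' hyn hzn
    refine ⟨?_, hzn1⟩
    have h1 := hz n hn' (hyn.trans hYr)
    have h2 := hy n hn' (hyn.trans hYr) (hzn1.trans hZβ)
    have h3 : y (n + 1) + μ * h * z (n + 1) + δ ≤
        (1 + c' * h) * (y n + μ * h * z n + δ) := by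
      have e1 : (c + μ) * h * z (n + 1) ≤ (c + μ) * h * (ρ * z n + c * y n + c * δ) := by
        gcongr
      have e2 : (c + μ) * ρ ≤ μ := by
        have := mul_nonneg hc h1ρ.le
        linarith
      have e3 : (c + μ) * ρ * (h * z n) ≤ μ * (h * z n) :=
        mul_le_mul_of_nonneg_right e2 (mul_nonneg hh (hz0 n))
      have e4 : 0 ≤ c' * h * (μ * h * z n) := by have := hz0 n; positivity
      rw [hc'] at e4 ⊢
      linarith
    have h4 : 1 + c' * h ≤ Real.exp (c' * h) := by
      linarith [Real.add_one_le_exp (c' * h)]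
    have h5 : 0 ≤ y n + μ * h * z n + δ := by
      have := hy0 n
      have := hz0 n
      positivity
    calc y (n + 1) + μ * h * z (n + 1) + δ
        ≤ (1 + c' * h) * (y n + μ * h * z n + δ) := h3
      _ ≤ Real.exp (c' * h) *
          (Real.exp (c' * (n * h)) * (y 0 + μ * h * z 0 + δ)) := by gcongr
      _ = _ := by
          rw [← mul_assoc, ← Real.exp_add]
          push_cast
          ring_nf

theorem Method.numU_succ (P : Method s) (N : ℝ → ℝ) (h v : ℝ) (Γ : Fin s → ℝ) (n : ℕ) :
    P.numU N h v Γ (n + 1) = P.numU N h v Γ n + h * ∑ i, P.b i *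
      P.numGammaPrev N h v Γ (n + 1) i *
        P.stages h (P.numU N h v Γ n) (P.numGammaPrev N h v Γ (n + 1)) i := by
  simp only [Method.numU, Method.numGammaPrev, Method.state, Function.iterate_succ_apply']
  rfl

theorem Method.numGammaPrev_succ (P : Method s) (N : ℝ → ℝ) (h v : ℝ) (Γ : Fin s → ℝ) (n : ℕ) :
    P.numGammaPrev N h v Γ (n + 1) =
      P.nextGamma N (P.numU N h v Γ n) (P.numGammaPrev N h v Γ n) := by
  simp only [Method.numU, Method.numGammaPrev, Method.state, Function.iterate_succ_apply']
  rfl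

theorem Method.abs_nextGamma_le (P : Method s) {N : ℝ → ℝ} {v a B B' : ℝ} {Γ : Fin s → ℝ}
    {i : Fin s} (ha : ∑ j, |P.D i j| + |P.θ i| ≤ a) (hB : 0 ≤ B) (hB' : 0 ≤ B')
    (hΓ : ∀ j, |Γ j| ≤ B) (hv : |N v| ≤ B') : |P.nextGamma N v Γ i| ≤ a * (B + B') := by
  have h1 := abs_sum_mul_le (P.D i) Γ le_rfl hB hΓ
  have h2 := mul_le_mul_of_nonneg_left hv (abs_nonneg (P.θ i))
  have h3 : 0 ≤ ∑ j, |P.D i j| := by positivity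
  have h4 := mul_le_mul_of_nonneg_right ha (add_nonneg hB hB')
  have h5 := mul_nonneg h3 hB'
  have h6 := mul_nonneg (abs_nonneg (P.θ i)) hB
  have h7 : P.nextGamma N v Γ i = ∑ j, P.D i j * Γ j + N v * P.θ i := rfl
  rw [h7]
  refine (abs_add_le _ _).trans ?_
  rw [abs_mul, mul_comm |N v|]
  linarith

theorem Method.abs_le_initErr (P : Method s) (N u : ℝ → ℝ) (h : ℝ) (Γ : Fin s → ℝ) (i : Fin s) :
    |Γ i - N (u (-h + P.c i * h))| ≤ P.initErr N u h Γ :=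
  le_ciSup (f := fun i => |Γ i - N (u (-h + P.c i * h))|) (Set.finite_range _).bddAbove i

theorem Method.initErr_nonneg (P : Method s) (N u : ℝ → ℝ) (h : ℝ) (Γ : Fin s → ℝ) :
    0 ≤ P.initErr N u h Γ :=
  Real.iSup_nonneg fun _ => abs_nonneg _

/-- The exact solution extends past both ends of `[0, T]`, and slightly before time `0` it stays
in the tube, with `N ∘ u` almost bounded by `M`. -/
theorem exists_time_margin {N : ℝ → ℝ} {Ω : Set ℝ} (hN : ContinuousOn N Ω) (hΩ : IsOpen Ω)
    {x₀ : ℝ} {u : ℝ → ℝ} {Tlo Thi : EReal} (hTlo : Tlo < 0)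
    (hu : IsSolutionOn N Ω x₀ u Tlo Thi) {T r M m : ℝ} (hT : 0 < T) (hTThi : (T : EReal) < Thi)
    (hr : 0 < r) (hm : 0 < m) (hM : |N (u 0)| ≤ M) :
    ∃ h₁, 0 < h₁ ∧ Icc (-h₁) (T + h₁) ⊆ {t : ℝ | Tlo < t ∧ (t : EReal) < Thi} ∧
      ∀ t ∈ Icc (-h₁) 0, u t ∈ tube u T r ∧ |N (u t)| ≤ M + m / 2 := by
  have hI := isOpen_setOf_between Tlo Thi
  have h0I : (0 : ℝ) ∈ {t : ℝ | Tlo < t ∧ (t : EReal) < Thi} :=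
    ⟨hTlo, lt_trans (by exact_mod_cast hT) hTThi⟩
  have hTI : T ∈ {t : ℝ | Tlo < t ∧ (t : EReal) < Thi} :=
    ⟨hTlo.trans (by exact_mod_cast hT), hTThi⟩
  have huc : ContinuousAt u 0 := (hu.deriv 0 h0I.1 h0I.2).continuousAt
  have hNu : ContinuousAt (fun t => N (u t)) 0 :=
    ContinuousAt.comp (f := u) (g := N)
      (hN.continuousAt (hΩ.mem_nhds (hu.mem 0 h0I.1 h0I.2))) huc
  have e1 : ∀ᶠ t in nhds (0 : ℝ), |u t - u 0| < r := by
    simpa [Real.dist_eq] using huc.eventually (Metric.ball_mem_nhds _ hr)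
  have e2 : ∀ᶠ t in nhds (0 : ℝ), |N (u t)| < M + m / 2 :=
    hNu.abs.eventually_lt_const (by linarith)
  obtain ⟨d, hd, hd'⟩ := Metric.eventually_nhds_iff.1 ((hI.eventually_mem h0I).and (e1.and e2))
  obtain ⟨d', hd0', hd''⟩ := Metric.eventually_nhds_iff.1 (hI.eventually_mem hTI)
  refine ⟨min (d / 2) (d' / 2), by positivity, fun t ht => ?_, fun t ht => ?_⟩
  · have h1 := min_le_left (d / 2) (d' / 2)
    have h2 := min_le_right (d / 2) (d' / 2)
    have hl : -(min (d / 2) (d' / 2)) ∈ {t : ℝ | Tlo < t ∧ (t : EReal) < Thi} := by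
      refine (hd' ?_).1
      rw [Real.dist_eq, sub_zero, abs_neg, abs_of_pos (by positivity)]
      linarith
    have hr' : T + min (d / 2) (d' / 2) ∈ {t : ℝ | Tlo < t ∧ (t : EReal) < Thi} := by
      refine hd'' ?_
      rw [Real.dist_eq, add_sub_cancel_left, abs_of_pos (by positivity)]
      linarith
    exact ⟨hl.1.trans_le (by exact_mod_cast ht.1), lt_of_le_of_lt (by exact_mod_cast ht.2) hr'.2⟩
  · have h1 := min_le_left (d / 2) (d' / 2)
    have := (hd' (y := t) (by
      rw [Real.dist_eq, sub_zero, abs_of_nonpos ht.2]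
      linarith [ht.1])).2
    exact ⟨⟨0, ⟨le_rfl, hT.le⟩, u t - u 0, this.1.le, by ring⟩, this.2.le⟩

/-- The exact values `N (u (t + (c i - 1) h))` approximated by the auxiliary vector that the
method carries at time `t`. -/
def Method.exactGamma (P : Method s) (N u : ℝ → ℝ) (h t : ℝ) : Fin s → ℝ :=
  fun i => N (u (t + (P.c i - 1) * h))

theorem Method.exactGamma_add (P : Method s) (N u : ℝ → ℝ) (h t : ℝ) (i : Fin s) :
    P.exactGamma N u h (t + h) i = N (u (t + P.c i * h)) := by
  unfold Method.exactGamma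
  congr 2
  ring

theorem Method.norm_exactGamma_sub_le (P : Method s) (N u : ℝ → ℝ) (h : ℝ) (Γ : Fin s → ℝ) :
    ‖P.exactGamma N u h 0 - Γ‖ ≤ P.initErr N u h Γ := by
  refine (pi_norm_le_iff_of_nonneg (P.initErr_nonneg N u h Γ)).2 fun i => ?_
  have := P.abs_le_initErr N u h Γ i
  rw [abs_sub_comm] at this
  have h1 : P.exactGamma N u h 0 i = N (u (-h + P.c i * h)) := by
    unfold Method.exactGamma
    congr 2
    ring
  rwa [Pi.sub_apply, h1]

/-- A component of the auxiliary vector is bounded by its exact value and the seminorm of the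
error. -/
theorem Method.abs_gamma_le {P : Method s} {q : Seminorm ℝ (Fin s → ℝ)}
    (hq : ∀ x, ‖x‖ ≤ q x) {N u : ℝ → ℝ} {h t B β : ℝ} {Γ : Fin s → ℝ} (i : Fin s)
    (hB : |P.exactGamma N u h t i| ≤ B) (hz : q (P.exactGamma N u h t - Γ) ≤ β) :
    |Γ i| ≤ B + β := by
  have h1 := ((norm_le_pi_norm (P.exactGamma N u h t - Γ) i).trans (hq _)).trans hz
  rw [Pi.sub_apply, Real.norm_eq_abs] at h1
  have h2 : Γ i = P.exactGamma N u h t i - (P.exactGamma N u h t i - Γ i) := by ring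
  rw [h2]
  exact (abs_sub _ _).trans (add_le_add hB h1)

/-- Data for the error analysis that do not depend on the step size: a seminorm `q` that
`D` contracts with ratio `ρ`, equivalent to the sup norm with constant `κ`; a bound `a` for the row
sums of the coefficients; a Lipschitz constant `L` of `N` along the trajectory; bounds `B` of
`N ∘ u` and `Um` of `u` on `[-h₁, T + h₁]`; and a constant `K` for the defects of the exact solution
over steps that start in `[0, T]`. -/
structure ErrorConstants (P : Method s) (N u : ℝ → ℝ) (T r h₁ : ℝ) where
  q : Seminorm ℝ (Fin s → ℝ)
  ρ : ℝ
  κ : ℝ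
  a : ℝ
  L : ℝ
  B : ℝ
  Um : ℝ
  K : ℝ
  ρ_nonneg : 0 ≤ ρ
  ρ_lt_one : ρ < 1
  κ_nonneg : 0 ≤ κ
  norm_le : ∀ x, ‖x‖ ≤ q x
  q_le : ∀ x, q x ≤ κ * ‖x‖
  q_mulVec_le : ∀ x, q (P.D.mulVec x) ≤ ρ * q x
  a_nonneg : 0 ≤ a
  A_le : ∀ i, ∑ j, |P.A i j| ≤ a
  b_le : ∑ j, |P.b j| ≤ a
  D_le : ∀ i, ∑ j, |P.D i j| + |P.θ i| ≤ a
  L_nonneg : 0 ≤ L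
  lipschitz : ∀ t ∈ Icc 0 T, ∀ x, |u t - x| ≤ r → |N (u t) - N x| ≤ L * |u t - x|
  B_nonneg : 0 ≤ B
  N_le : ∀ t ∈ Icc (-h₁) (T + h₁), |N (u t)| ≤ B
  Um_nonneg : 0 ≤ Um
  u_le : ∀ t ∈ Icc (-h₁) (T + h₁), |u t| ≤ Um
  K_nonneg : 0 ≤ K
  defect_le : ∀ h, 0 ≤ h → h ≤ h₁ → ∀ t ∈ Icc 0 T,
    (∀ i, |N (u (t + P.c i * h)) - ∑ j, P.D i j * N (u (t + (P.c j - 1) * h)) -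
      P.θ i * N (u t)| ≤ K * h ^ s) ∧
    (∀ i, |u (t + P.c i * h) - u t -
      h * ∑ j, P.A i j * (N (u (t + P.c j * h)) * u (t + P.c j * h))| ≤ K * (h * h ^ s)) ∧
    |u (t + h) - u t -
      h * ∑ j, P.b j * (N (u (t + P.c j * h)) * u (t + P.c j * h))| ≤ K * (h * h ^ s)

theorem exists_errorConstants (hs : 1 ≤ s) {P : Method s} (hcoll : P.IsCollocation)
    (hstab : P.IsStronglyStable) (hcons : P.IsConsistent) {N : ℝ → ℝ} {Ω : Set ℝ}
    (hΩ : IsOpen Ω) (hN : ContDiffOn ℝ s N Ω) {x₀ : ℝ}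
    {u : ℝ → ℝ} {Tlo Thi : EReal} (hu : IsSolutionOn N Ω x₀ u Tlo Thi) {T r h₁ : ℝ}
    (hh₁ : 0 ≤ h₁) (hr : 0 ≤ r) (hV : tube u T r ⊆ Ω)
    (hJ : Icc (-h₁) (T + h₁) ⊆ {t : ℝ | Tlo < t ∧ (t : EReal) < Thi}) :
    Nonempty (ErrorConstants P N u T r h₁) := by
  have huI := (hu.contDiffOn hN).continuousOn
  have hNu : ContinuousOn (fun t => N (u t)) {t : ℝ | Tlo < t ∧ (t : EReal) < Thi} :=
    hN.continuousOn.comp huI fun t ht => hu.mem t ht.1 ht.2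
  obtain ⟨q, ρ, κ, hρ, hρ1, hκ, hq1, hq2, hq3⟩ := exists_contracting_seminorm P.D hstab
  obtain ⟨a, ha, hA, hb, hD⟩ := P.exists_coeff_bound
  obtain ⟨L, hL, hL'⟩ := exists_lipschitz_on_tube hΩ (hN.of_le (by exact_mod_cast hs))
    (huI.mono ((Icc_subset_Icc (by linarith) (by linarith)).trans hJ)) hr hV
  obtain ⟨B, hB⟩ := isCompact_Icc.exists_bound_of_continuousOn (hNu.mono hJ)
  obtain ⟨Um, hUm⟩ := isCompact_Icc.exists_bound_of_continuousOn (huI.mono hJ)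
  obtain ⟨K, hK, hdef⟩ := exists_defect_bound hs hcoll hcons hN hu hJ
  exact ⟨⟨q, ρ, κ, a, L, max B 0, max Um 0, K, hρ.le, hρ1, hκ, hq1, hq2, hq3, ha, hA, hb, hD,
    hL, hL', le_max_right _ _, fun t ht => (hB t ht).trans (le_max_left _ _),
    le_max_right _ _, fun t ht => (hUm t ht).trans (le_max_left _ _), hK, hdef⟩⟩

namespace ErrorConstants

variable {P : Method s} {N u : ℝ → ℝ} {T r h₁ : ℝ} (E : ErrorConstants P N u T r h₁)

/-- A common constant for all terms of the error recursion, when the auxiliary vectors are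
bounded by `B + m`. -/
def c (m : ℝ) : ℝ :=
  E.q P.θ * E.L + E.κ * E.K + 2 * (E.a * (E.B + m)) + 2 * (E.a * E.Um) + 2 * E.K

/-- Weight of the auxiliary error in the combined error. -/
def μ (m : ℝ) : ℝ := E.c m / (1 - E.ρ)

/-- Exponential growth rate of the combined error. -/
def rate (m : ℝ) : ℝ := E.c m + (E.c m + E.μ m) * E.c m

theorem c_nonneg {m : ℝ} (hm : 0 ≤ m) : 0 ≤ E.c m := by
  have := E.κ_nonneg
  have := E.a_nonneg
  have := E.L_nonneg
  have := E.B_nonneg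
  have := E.Um_nonneg
  have := E.K_nonneg
  unfold c
  positivity

theorem μ_nonneg {m : ℝ} (hm : 0 ≤ m) : 0 ≤ E.μ m :=
  div_nonneg (E.c_nonneg hm) (by linarith [E.ρ_lt_one])

theorem rate_nonneg {m : ℝ} (hm : 0 ≤ m) : 0 ≤ E.rate m := by
  have := E.c_nonneg hm
  have := E.μ_nonneg hm
  unfold rate
  positivity

/-- Each summand of `c m` is a lower bound for it. -/
theorem le_c {m : ℝ} (hm : 0 ≤ m) :
    E.q P.θ * E.L ≤ E.c m ∧ E.κ * E.K ≤ E.c m ∧ 2 * (E.a * (E.B + m)) ≤ E.c m ∧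
      2 * (E.a * E.Um) ≤ E.c m ∧ 2 * E.K ≤ E.c m := by
  have h1 : 0 ≤ E.q P.θ * E.L := mul_nonneg (apply_nonneg _ _) E.L_nonneg
  have h2 := mul_nonneg E.κ_nonneg E.K_nonneg
  have h3 := mul_nonneg E.a_nonneg (add_nonneg E.B_nonneg hm)
  have h4 := mul_nonneg E.a_nonneg E.Um_nonneg
  have h5 := E.K_nonneg
  unfold c
  refine ⟨?_, ?_, ?_, ?_, ?_⟩ <;> linarith

theorem abs_exactGamma_le (hc : ∀ i, P.c i ∈ Icc (0 : ℝ) 1) {h t : ℝ} (hh : 0 ≤ h)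
    (hh₁ : h ≤ h₁) (ht : t ∈ Icc 0 (T + h)) (i : Fin s) :
    |P.exactGamma N u h t i| ≤ E.B := by
  have h1 := mul_nonneg (hc i).1 hh
  have h2 := mul_le_of_le_one_left hh (hc i).2
  exact E.N_le _ ⟨by linarith [ht.1], by linarith [ht.2]⟩

/-- The numerical solution stays in the tube and satisfies the error bounds, as long as the
bounds `Y` and `Z` predicted by the recursion respect the margins `r` and `m`. -/
theorem error_bounds (hc : ∀ i, P.c i ∈ Icc (0 : ℝ) 1) {m h v Y Z : ℝ} {Γ : Fin s → ℝ}
    (hm : 0 ≤ m) (hh : 0 < h) (hh₁ : h ≤ h₁) (hsmall : h * (E.a * (E.B + m)) ≤ 1 / 2)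
    (hY : Y = Real.exp (E.rate m * T) *
      (|u 0 - v| + E.μ m * h * E.q (P.exactGamma N u h 0 - Γ) + h ^ s)) (hYr : Y ≤ r)
    (hZ : Z = E.q (P.exactGamma N u h 0 - Γ) + E.μ m * (Y + h ^ s)) (hZm : Z ≤ m)
    (n : ℕ) (hn : n * h ≤ T) :
    |u (n * h) - P.numU N h v Γ n| ≤ Real.exp (E.rate m * (n * h)) *
      (|u 0 - v| + E.μ m * h * E.q (P.exactGamma N u h 0 - Γ) + h ^ s) ∧
    |u (n * h) - P.numU N h v Γ n| ≤ Y ∧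
    E.q (P.exactGamma N u h (n * h) - P.numGammaPrev N h v Γ n) ≤ Z ∧
    E.q (P.exactGamma N u h (n * h + h) - P.numGammaPrev N h v Γ (n + 1)) ≤ Z := by
  obtain ⟨c1, c2, c3, c4, c5⟩ := E.le_c hm
  have hc0 := E.c_nonneg hm
  have hδ : 0 ≤ h ^ s := by positivity
  have hn0 : ∀ n : ℕ, 0 ≤ (n : ℝ) * h := fun n => by positivity
  have hcast : ∀ n : ℕ, ((n + 1 : ℕ) : ℝ) * h = n * h + h := fun n => by push_cast; ring
  have key := coupled_recursion_bound (y := fun n => |u (n * h) - P.numU N h v Γ n|)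
    (z := fun n => E.q (P.exactGamma N u h (n * h) - P.numGammaPrev N h v Γ n))
    (h := h) (δ := h ^ s) (μ := E.μ m) (c' := E.rate m) (T := T) (r := r) (β := m) (Y := Y) (Z := Z) E.ρ_nonneg E.ρ_lt_one
    hc0 hh.le hδ rfl rfl (fun _ => abs_nonneg _) (fun _ => apply_nonneg _ _) ?_ ?_
    (by simpa [Method.numU, Method.numGammaPrev, Method.state] using hY) hYr
    (by simpa [Method.numGammaPrev, Method.state] using hZ) hZm n hn
  · obtain ⟨k1, k2, k3, k4⟩ := key
    refine ⟨?_, k2, k3, by simpa only [hcast] using k4⟩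
    have h1 : 0 ≤ E.μ m * h * E.q (P.exactGamma N u h (n * h) - P.numGammaPrev N h v Γ n) :=
      mul_nonneg (mul_nonneg (E.μ_nonneg hm) hh.le) (apply_nonneg _ _)
    have h2 : |u (n * h) - P.numU N h v Γ n| ≤ _ := le_trans (by linarith) k1
    simpa [Method.numU, Method.numGammaPrev, Method.state] using h2
  · intro n hn hyn
    have h1 := P.seminorm_nextGamma_error_le E.κ_nonneg E.q_le E.q_mulVec_le
      (mul_nonneg E.K_nonneg hδ) (E.lipschitz (n * h) ⟨hn0 n, hn⟩ _ hyn)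
      (le_refl (E.q (P.exactGamma N u h (n * h) - P.numGammaPrev N h v Γ n))) E.ρ_nonneg
      (G' := P.exactGamma N u h (n * h + h))
      (fun i => by
        rw [P.exactGamma_add]
        exact (E.defect_le h hh.le hh₁ (n * h) ⟨hn0 n, hn⟩).1 i)
    simp only [hcast, P.numGammaPrev_succ]
    refine h1.trans ?_
    have e1 := mul_le_mul_of_nonneg_right c1 (abs_nonneg (u (n * h) - P.numU N h v Γ n))
    have e2 := mul_le_mul_of_nonneg_right c2 hδ
    linarith
  · intro n hn hyn hzn
    simp only [hcast] at hzn ⊢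
    have hg : ∀ i, |P.numGammaPrev N h v Γ (n + 1) i| ≤ E.B + m := fun i =>
      P.abs_gamma_le E.norm_le i (E.abs_exactGamma_le hc hh.le hh₁
        ⟨by linarith [hn0 n], by linarith⟩ i) hzn
    have hB : 0 ≤ E.B + m := add_nonneg E.B_nonneg hm
    -- the stage system is solvable, so `stages` is a genuine solution
    have hst := Classical.epsilon_spec
      (P.existsUnique_isStageSolution (v := P.numU N h v Γ n) E.A_le hh.le hB hg hsmall).exists
    obtain ⟨-, d2, d3⟩ := E.defect_le h hh.le hh₁ (n * h) ⟨hn0 n, hn⟩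
    have h1 := P.abs_step_error_le (η := E.q (P.exactGamma N u h (n * h + h) -
        P.numGammaPrev N h v Γ (n + 1))) (X := fun j => u (n * h + P.c j * h))
      (G := fun j => N (u (n * h + P.c j * h)))
      E.A_le E.b_le E.a_nonneg hh.le hB E.Um_nonneg
      (mul_nonneg E.K_nonneg (mul_nonneg hh.le hδ)) (apply_nonneg _ _) hg
      (fun j => E.u_le _ ⟨by nlinarith [hn0 n, (hc j).1], by nlinarith [(hc j).2]⟩)
      (fun j => by
        rw [← P.exactGamma_add N u h (n * h) j]
        exact (norm_le_pi_norm (P.exactGamma N u h (n * h + h) -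
          P.numGammaPrev N h v Γ (n + 1)) j).trans (E.norm_le _))
      hsmall hst d2 d3
    rw [P.numU_succ]
    refine h1.trans ?_
    have e1 := mul_le_mul_of_nonneg_right c3
      (mul_nonneg hh.le (abs_nonneg (u (n * h) - P.numU N h v Γ n)))
    have e2 := mul_le_mul_of_nonneg_right c4 (mul_nonneg hh.le (apply_nonneg E.q
      (P.exactGamma N u h (n * h + h) - P.numGammaPrev N h v Γ (n + 1))))
    have e3 := mul_le_mul_of_nonneg_right c5 (mul_nonneg hh.le hδ)
    linarith

end ErrorConstants

/-! ### Convergence -/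

/-- Finitely many smallness conditions on the step size can be met simultaneously. -/
theorem exists_small_step {h₁ X₁ X₂ X₃ X₄ δ r m : ℝ} (hh₁ : 0 < h₁) (hδ : 0 < δ) (hr : 0 < r)
    (hm : 0 < m) : ∃ h₀, 0 < h₀ ∧ h₀ ≤ h₁ ∧ h₀ ≤ 1 ∧ h₀ * X₁ < 1 / 2 ∧ h₀ * X₂ < 1 / 2 ∧
      h₀ * X₃ < δ ∧ h₀ * X₄ < r ∧ h₀ * X₄ < m := by
  have key : ∀ X y : ℝ, 0 < y → ∀ᶠ h in nhdsWithin (0 : ℝ) (Ioi 0), h * X < y := fun X y hy => by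
    have h1 : Filter.Tendsto (fun h : ℝ => h * X) (nhds 0) (nhds 0) := by
      simpa using (continuous_mul_const X).tendsto (0 : ℝ)
    exact (h1.mono_left nhdsWithin_le_nhds).eventually_lt_const hy
  obtain ⟨h, h0, h1, h2, h3, h4, h5, h6, h7⟩ := ((eventually_mem_nhdsWithin).and
    ((key 1 h₁ hh₁).and ((key 1 1 one_pos).and ((key X₁ _ one_half_pos).and
      ((key X₂ _ one_half_pos).and ((key X₃ δ hδ).and ((key X₄ r hr).and
        (key X₄ m hm)))))))).exists
  rw [mul_one] at h1 h2
  exact ⟨h, h0, h1.le, h2.le, h3, h4, h5, h6, h7⟩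

end LinImplicit

end

theorem mainTheorem3 (s : ℕ) (hs : 1 ≤ s) (P : LinImplicit.Method s)
    (hcoll : P.IsCollocation) (hstab : P.IsStronglyStable) (hcons : P.IsConsistent)
    (Ω : Set ℝ) (hΩ : IsOpen Ω) (N : ℝ → ℝ) (hN : ContDiffOn ℝ s N Ω)
    (x₀ : ℝ) (hx₀ : x₀ ∈ Ω) (u : ℝ → ℝ) (Tlo Thi : EReal)
    (hTlo : Tlo < 0) (hu : LinImplicit.IsSolutionOn N Ω x₀ u Tlo Thi)
    (T : ℝ) (hT : 0 < T) (hTThi : (T : EReal) < Thi)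
    (r : ℝ) (hr : 0 < r) (hV : LinImplicit.tube u T r ⊆ Ω)
    (M : ℝ) (hM : M = sSup ((fun t => |N (u t)|) '' Set.Icc 0 T))
    (m : ℝ) (hm : 0 < m)
    (hMm : sSup ((fun x => |N x|) '' LinImplicit.tube u T r) < M + m) :
    ∃ C > 0, ∃ h₀ > 0,
      -- the exact solution is defined at the starting points, with values in the tube,
      -- and the closeness conditions below are satisfied by the exact data
      Tlo < ((-h₀ : ℝ) : EReal) ∧
      (∀ t ∈ Set.Icc (-h₀) 0, u t ∈ LinImplicit.tube u T r) ∧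
      C * Real.exp (C * T) * h₀ ^ s < r ∧
      C * Real.exp (C * T) * h₀ ^ s < m ∧
      ∀ h : ℝ, 0 < h → h < h₀ → ∀ (v₀ : ℝ) (Γ : Fin s → ℝ),
        Real.exp (C * T) * (|x₀ - v₀| + C * (P.initErr N u h Γ + h₀ ^ s)) < r →
        C * Real.exp (C * T) * (|x₀ - v₀| + P.initErr N u h Γ + h₀ ^ s) < m →
        (∀ n : ℕ, ((n : ℝ) - 1) * h ≤ T →
          P.numU N h v₀ Γ n ∈ Ω ∧
          ∃! U : Fin s → ℝ,
            P.IsStageSolution h (P.numU N h v₀ Γ n) (P.numGammaPrev N h v₀ Γ (n + 1)) U) ∧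
        (∀ n : ℕ, (n : ℝ) * h ≤ T →
          (∀ i, |P.numGammaPrev N h v₀ Γ n i| ≤ M + m) ∧
          ∀ k ≤ n, |u (k * h) - P.numU N h v₀ Γ k| ≤
            Real.exp (C * n * h) * (|x₀ - v₀| + C * (P.initErr N u h Γ + h ^ s))) := by
  have hu0 : u 0 = x₀ := hu.init
  have huT : ContinuousOn u (Set.Icc 0 T) := fun t ht =>
    (hu.deriv t (hTlo.trans_le (by exact_mod_cast ht.1))
      (lt_of_le_of_lt (by exact_mod_cast ht.2) hTThi)).continuousAt.continuousWithinAt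
  have hVc := LinImplicit.isCompact_tube huT r
  have hmemV : ∀ t ∈ Set.Icc 0 T, ∀ x, |u t - x| ≤ r → x ∈ LinImplicit.tube u T r :=
    fun t ht x hx => ⟨t, ht, x - u t, by rwa [abs_sub_comm], by ring⟩
  have hNM : ∀ t ∈ Set.Icc 0 T, |N (u t)| ≤ M := fun t ht => by
    have hcont : ContinuousOn (fun t => |N (u t)|) (Set.Icc 0 T) :=
      (hN.continuousOn.comp huT fun t ht => hV (hmemV t ht _ (by simpa using hr.le))).abs
    rw [hM]
    exact le_csSup (isCompact_Icc.image_of_continuousOn hcont).bddAbove (Set.mem_image_of_mem _ ht)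
  obtain ⟨h₁, hh₁, hJ, hback⟩ := LinImplicit.exists_time_margin hN.continuousOn hΩ hTlo hu hT
    hTThi hr hm (hNM 0 ⟨le_rfl, hT.le⟩)
  obtain ⟨E⟩ := LinImplicit.exists_errorConstants hs hcoll hstab hcons hΩ hN hu hh₁.le hr.le hV hJ
  -- the value computed by the step that crosses `T` lies in a thickening `W` of the tube
  obtain ⟨δ, hδ, hW⟩ := hVc.exists_cthickening_subset_open hΩ hV
  obtain ⟨B₂, hB₂⟩ := hVc.cthickening.exists_bound_of_continuousOn (hN.continuousOn.mono hW)
  -- one half of `m` absorbs the variation of `N ∘ u` on `[-h₀, 0]`, the other half the error of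
  -- the auxiliary vector
  have hm2 : 0 ≤ m / 2 := by positivity
  have hμ := E.μ_nonneg hm2
  have hrate := E.rate_nonneg hm2
  have hκ := E.κ_nonneg
  have ha := E.a_nonneg
  have hB : 0 ≤ E.B + m / 2 := add_nonneg E.B_nonneg hm2
  set μ := E.μ (m / 2) with hμ_def
  set R := E.rate (m / 2) with hR_def
  -- `C₁` serves the error estimate, and `C ≥ 2 (κ + 2 μ) C₁` also bounds the auxiliary error
  set C₁ := 1 + μ * E.κ + R with hC₁
  have hμκ : 0 ≤ μ * E.κ := mul_nonneg hμ hκ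
  have hC₁1 : 1 ≤ C₁ := by linarith
  set C := 2 * (C₁ * (E.κ + 2 * μ + 1)) with hC
  have hCC₁ : C₁ ≤ C := by
    have : 0 ≤ C₁ * (E.κ + 2 * μ) := by positivity
    linarith
  have hC0 : 0 < C := by linarith
  -- bound for the auxiliary vector computed from a value `u_n` in `W`
  set B₃ := E.a * (E.B + m / 2 + max B₂ 0) with hB₃
  have hB₃0 : 0 ≤ B₃ := mul_nonneg ha (add_nonneg hB (le_max_right _ _))
  obtain ⟨h₀, hh₀, hh₀₁, hh₀1, hs1, hs2, hs3, hs4, hs5⟩ := LinImplicit.exists_small_step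
    (X₁ := E.a * (E.B + m / 2)) (X₂ := E.a * B₃)
    (X₃ := E.a * ((E.B + m / 2) * (2 * (E.Um + r)))) (X₄ := C * Real.exp (C * T)) hh₁ hδ hr hm
  have hpow : h₀ ^ s ≤ h₀ := pow_le_of_le_one hh₀.le hh₀1 (by omega)
  have hpow' : C * Real.exp (C * T) * h₀ ^ s ≤ h₀ * (C * Real.exp (C * T)) := by
    rw [mul_comm h₀]
    gcongr
  have hJl := (hJ (show -h₁ ∈ Set.Icc (-h₁) (T + h₁) from ⟨le_rfl, by linarith⟩)).1
  refine ⟨C, hC0, h₀, hh₀, hJl.trans_le (by exact_mod_cast neg_le_neg hh₀₁),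
    fun t ht => (hback t ⟨by linarith [ht.1], ht.2⟩).1, hpow'.trans_lt hs4, hpow'.trans_lt hs5,
    fun h hh hhh₀ v Γ hcl₁ hcl₂ => ?_⟩
  have hle : ∀ {X Y : ℝ}, 0 ≤ X → h₀ * X < Y → h * X ≤ Y := fun hX hXY =>
    ((mul_le_mul_of_nonneg_right hhh₀.le hX).trans_lt hXY).le
  have hsmall : h * (E.a * (E.B + m / 2)) ≤ 1 / 2 := hle (by positivity) hs1
  have hsmall₃ : h * (E.a * B₃) ≤ 1 / 2 := hle (by positivity) hs2
  have hh₁' : h ≤ h₁ := hhh₀.le.trans hh₀₁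
  set ε := P.initErr N u h Γ with hε
  have hε0 : 0 ≤ ε := P.initErr_nonneg N u h Γ
  have hδs : h ^ s ≤ h₀ ^ s := pow_le_pow_left₀ hh.le hhh₀.le s
  have hs0 : 0 ≤ h ^ s := by positivity
  set z₀ := E.q (P.exactGamma N u h 0 - Γ) with hz₀
  have hz₀0 : 0 ≤ z₀ := apply_nonneg _ _
  have hz₀ε : z₀ ≤ E.κ * ε := (E.q_le _).trans
    (mul_le_mul_of_nonneg_left (P.norm_exactGamma_sub_le N u h Γ) hκ)
  rw [← hu0] at hcl₁ hcl₂ ⊢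
  set y₀ := |u 0 - v| with hy₀
  have hy₀0 : 0 ≤ y₀ := abs_nonneg _
  have hw : y₀ + μ * h * z₀ + h ^ s ≤ y₀ + C₁ * (ε + h ^ s) := by
    have e1 : μ * h * z₀ ≤ μ * 1 * (E.κ * ε) := by
      gcongr
      linarith
    have e2 : 0 ≤ (1 + R) * ε := by positivity
    have e3 : 0 ≤ (μ * E.κ + R) * h ^ s := by positivity
    rw [hC₁]
    linarith
  have hRC : R ≤ C := by linarith
  set Y := Real.exp (R * T) * (y₀ + μ * h * z₀ + h ^ s) with hY
  set Z := z₀ + μ * (Y + h ^ s) with hZ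
  have hexp : Real.exp (R * T) ≤ Real.exp (C * T) := by gcongr
  have hYr : Y ≤ r := by
    refine le_trans ?_ hcl₁.le
    refine mul_le_mul hexp (hw.trans ?_) (by positivity) (Real.exp_pos _).le
    gcongr
  have hZm : Z ≤ m / 2 := by
    set S := y₀ + ε + h₀ ^ s with hS
    have hS0 : 0 ≤ S := by positivity
    set F := Real.exp (C * T) with hF
    have hF1 : 1 ≤ F := Real.one_le_exp (by positivity)
    have hFC : 1 ≤ F * C₁ := one_le_mul_of_one_le_of_one_le hF1 hC₁1
    have hSF : S ≤ F * C₁ * S := le_mul_of_one_le_left hS0 hFC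
    have e1 : Y ≤ F * C₁ * S := by
      rw [mul_assoc]
      refine mul_le_mul hexp (hw.trans ?_) (by positivity) (by positivity)
      have f1 : y₀ ≤ C₁ * y₀ := le_mul_of_one_le_left hy₀0 hC₁1
      have f2 : C₁ * h ^ s ≤ C₁ * h₀ ^ s := by gcongr
      rw [hS]
      linarith
    have e2 : ε ≤ F * C₁ * S := le_trans (by rw [hS]; linarith) hSF
    have e3 : h ^ s ≤ F * C₁ * S := le_trans (by rw [hS]; linarith) hSF
    have e4 : z₀ ≤ E.κ * (F * C₁ * S) := hz₀ε.trans (by gcongr)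
    have e5 : μ * (Y + h ^ s) ≤ μ * (F * C₁ * S + F * C₁ * S) := by gcongr
    have e6 : 0 ≤ F * C₁ * S := by positivity
    have e7 : C * F * S = 2 * (E.κ * (F * C₁ * S) + μ * (F * C₁ * S + F * C₁ * S) +
        F * C₁ * S) := by rw [hC]; ring
    linarith
  have hbounds := E.error_bounds hcoll.mem_Icc (v := v) (Γ := Γ) hm2 hh hh₁' hsmall hY hYr hZ hZm
  have hn0 : ∀ n : ℕ, 0 ≤ (n : ℝ) * h := fun n => by positivity
  have hγM : ∀ n : ℕ, (n : ℝ) * h ≤ T → ∀ i, |P.numGammaPrev N h v Γ n i| ≤ M + m := by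
    intro n hn i
    have h1 : |P.exactGamma N u h (n * h) i| ≤ M + m / 2 := by
      have c0 := mul_nonneg (hcoll.mem_Icc i).1 hh.le
      have c1 := mul_le_of_le_one_left hh.le (hcoll.mem_Icc i).2
      -- for `n = 0` the nodes lie before time `0`
      rcases le_total (n * h + (P.c i - 1) * h) 0 with ht | ht
      · exact (hback _ ⟨by linarith [hn0 n], ht⟩).2
      · exact (hNM _ ⟨ht, by linarith⟩).trans (by linarith)
    have := P.abs_gamma_le E.norm_le i h1 ((hbounds n hn).2.2.1.trans hZm)
    linarith
  have hγB : ∀ n : ℕ, (n : ℝ) * h ≤ T → ∀ i, |P.numGammaPrev N h v Γ (n + 1) i| ≤ E.B + m / 2 :=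
    fun n hn i => P.abs_gamma_le E.norm_le i (E.abs_exactGamma_le hcoll.mem_Icc hh.le hh₁'
      ⟨by linarith [hn0 n], by linarith⟩ i) ((hbounds n hn).2.2.2.trans hZm)
  have hUV : ∀ n : ℕ, (n : ℝ) * h ≤ T → P.numU N h v Γ n ∈ LinImplicit.tube u T r :=
    fun n hn => hmemV _ ⟨hn0 n, hn⟩ _ ((hbounds n hn).2.1.trans hYr)
  refine ⟨fun n hn => ?_, fun n hn => ⟨hγM n hn, fun k hk => ?_⟩⟩
  · have hmain : P.numU N h v Γ n ∈ Metric.cthickening δ (LinImplicit.tube u T r) ∧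
        ∀ i, |P.numGammaPrev N h v Γ n i| ≤ E.B + m / 2 := by
      cases n with
      | zero =>
        have h0T : ((0 : ℕ) : ℝ) * h ≤ T := by simpa using hT.le
        refine ⟨Metric.self_subset_cthickening _ (hUV 0 h0T), fun i => ?_⟩
        exact P.abs_gamma_le E.norm_le i (E.abs_exactGamma_le hcoll.mem_Icc hh.le hh₁'
          ⟨hn0 0, by linarith⟩ i) ((hbounds 0 h0T).2.2.1.trans hZm)
      | succ n =>
        have hn' : (n : ℝ) * h ≤ T := by simpa using hn
        refine ⟨Metric.mem_cthickening_of_dist_le _ _ _ _ (hUV n hn') ?_, hγB n hn'⟩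
        have hst := Classical.epsilon_spec (P.existsUnique_isStageSolution
          (v := P.numU N h v Γ n) E.A_le hh.le hB (hγB n hn') hsmall).exists
        have hmove := P.abs_sum_stage_le E.A_le E.b_le hh.le hB (hγB n hn') hsmall hst
        rw [P.numU_succ, Real.dist_eq, add_sub_cancel_left]
        have habs : |P.numU N h v Γ n| ≤ E.Um + r := by
          have h1 := E.u_le (n * h) ⟨by linarith [hn0 n], by linarith⟩
          have h2 := (hbounds n hn').2.1.trans hYr
          have h3 : P.numU N h v Γ n = u (n * h) - (u (n * h) - P.numU N h v Γ n) := by ring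
          rw [h3]
          exact (abs_sub _ _).trans (add_le_add h1 h2)
        refine hmove.trans (le_trans ?_ (hle (Y := δ) ?_ hs3))
        · gcongr
        · have := E.Um_nonneg
          positivity
    refine ⟨hW hmain.1, ?_⟩
    rw [P.numGammaPrev_succ]
    exact P.existsUnique_isStageSolution E.A_le hh.le hB₃0 (fun i => P.abs_nextGamma_le (E.D_le i)
      hB (le_max_right _ _) hmain.2 ((hB₂ _ hmain.1).trans (le_max_left _ _))) hsmall₃
  · have hkn : (k : ℝ) * h ≤ n * h := by gcongr
    refine (hbounds k (hkn.trans hn)).1.trans ?_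
    refine mul_le_mul ?_ (hw.trans ?_) (by positivity) (Real.exp_pos _).le
    · rw [Real.exp_le_exp, mul_assoc C]
      exact mul_le_mul hRC hkn (hn0 k) hC0.le
    · gcongr
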